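/- Let $n\ge 0$ be an integer and $\lambda\in\mathbb C$. Let $C^\infty(\mathbb R^n)$ be the algebra of smooth complex-valued functions of $u=(u_1,\dots,u_n)$, where $\mathbb R^n=\{[1,u_1,\dots,u_n]\}$ is the big cell of $\mathbb{RP}^n$. Let $\mathcal P=C^\infty(\mathbb R^n)[\xi_1,\dots,\xi_n]$ be the algebra of smooth functions on $T^*\mathbb R^n$ that are polynomial along the fibres, graded by the degree in $\xi$, $\mathcal P=\bigoplus_d\mathcal P^d$, with Poisson bracket $\{p,q\}=\sum_i\left(\frac{\partial p}{\partial \xi_i}\frac{\partial q}{\partial u_i}-\frac{\partial p}{\partial u_i}\frac{\partial q}{\partial \xi_i}\right)$. Let $\mathcal D^\lambda$ be the algebra of smooth linear differential operators on $\lambda$-densities on $\mathbb R^n$; identifying $f\,|du|^\lambda$ with $f$, it consists of the finite sums $\sum_a f_a\,\partial_u^a$ with $f_a\in C^\infty(\mathbb R^n)$. For $x\in\mathfrak{sl}_{n+1}(\mathbb R)$ let $\eta^x=\sum_i\eta^x_i\,\partial/\partial u_i$ be the vector field on $\mathbb R^n$ induced by the action on $\mathbb{RP}^n$, $\mu^x=\sum_i\eta^x_i\xi_i$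 its symbol, and $\eta^x_\lambda=\eta^x+\lambda\operatorname{div}\eta^x$ its Lie derivative on $\lambda$-densities. There is exactly one $\mathbb C$-linear isomorphism $\mathcal Q_\lambda:\mathcal P\to\mathcal D^\lambda$ such that, for all $d$ and all $\varphi\in\mathcal P^d$, the operator $\mathcal Q_\lambda(\varphi)$ has order at most $d$ and degree-$d$ principal symbol $\varphi$, and such that $\mathcal Q_\lambda(\{\mu^x,\varphi\})=[\eta^x_\lambda,\mathcal Q_\lambda(\varphi)]$ for all $x\in\mathfrak{sl}_{n+1}(\mathbb R)$ and $\varphi\in\mathcal P$. Let $\mathcal Q_{\lambda,t}:\mathcal P[t]\to\mathcal D^\lambda[t]$ be the $\mathbb C[t]$-linear map with $\mathcal Q_{\lambda,t}(\varphi)=t^d\mathcal Q_\lambda(\varphi)$ for $\varphi\in\mathcal P^d$. It is injective, and one puts $\Phi\star_\lambda\Psi=\mathcal Q_{\lambda,t}^{-1}\bigl(\mathcal Q_{\lambda,t}(\Phi)\,\mathcal Q_{\lambda,t}(\Psi)\bigr)$. Then, for every $\phi\in C^\infty(\mathbb R^n)$ and every $\psi\in\mathbb C[\xi_1,\dots,\xi_n]$,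 the product $\mathcal Q_{\lambda,t}(\phi)\,\mathcal Q_{\lambda,t}(\psi)$ lies in the image of $\mathcal Q_{\lambda,t}$ and $$\phi\star_\lambda\psi=\mathbf g_\lambda(\phi\psi),\qquad \mathbf g_\lambda=1+\sum_{d\ge1}g_{\lambda,d}\,D^d\,t^d,\qquad g_{\lambda,d}=\frac1{d!}\prod_{j=0}^{d-1}\frac{-E-j-\lambda(n+1)}{2E+j+n+1},$$ where $D=\sum_{i=1}^n\frac{\partial^2}{\partial u_i\,\partial\xi_i}$, $E=\sum_{i=1}^n\xi_i\frac{\partial}{\partial\xi_i}$, and $\frac{1}{2E+j+n+1}$ is the inverse of the (invertible) operator $2E+j+n+1$ on $\mathcal P$. -/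

import Mathlib

open scoped ContDiff Polynomial

noncomputable section

namespace ProjStar

/-- The algebra of smooth complex-valued functions on the big cell `ℝⁿ`. -/
def smoothSubalgebra (n : ℕ) : Subalgebra ℂ ((Fin n → ℝ) → ℂ) where
  carrier := {f | ContDiff ℝ ∞ f}
  mul_mem' hf hg := by
    rw [Set.mem_ofPred_eq] at hf hg ⊢
    exact hf.mul hg
  add_mem' hf hg := by
    rw [Set.mem_ofPred_eq] at hf hg ⊢
    exact hf.add hg
  algebraMap_mem' c := (contDiff_const : ContDiff ℝ ∞ fun _ : Fin n → ℝ => c)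

/-- The type of smooth complex-valued functions on the big cell `ℝⁿ`. -/
def Smooth (n : ℕ) : Type := smoothSubalgebra n

instance (n : ℕ) : CommRing (Smooth n) := inferInstanceAs (CommRing (smoothSubalgebra n))

instance (n : ℕ) : Algebra ℂ (Smooth n) := inferInstanceAs (Algebra ℂ (smoothSubalgebra n))

instance (n : ℕ) : CoeFun (Smooth n) fun _ => (Fin n → ℝ) → ℂ := ⟨fun f => f.1⟩

theorem Smooth.ext {n : ℕ} {f g : Smooth n} (h : ∀ u, f u = g u) : f = g :=
  Subtype.ext (funext h)

theorem Smooth.contDiff {n : ℕ} (f : Smooth n) : ContDiff ℝ ∞ (fun u => f u) := f.2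

theorem Smooth.differentiableAt {n : ℕ} (f : Smooth n) (u : Fin n → ℝ) :
    DifferentiableAt ℝ (fun u => f u) u := f.contDiff.differentiable (by simp) u

/-- The partial derivative `∂/∂uᵢ` on smooth functions. -/
def pd {n : ℕ} (i : Fin n) : Module.End ℂ (Smooth n) where
  toFun f := ⟨fun u => fderiv ℝ (fun v => f v) u (Pi.single i 1),
    show ContDiff ℝ ∞ fun u => fderiv ℝ (fun v => f v) u (Pi.single i 1) from
      (ContDiff.fderiv_right (m := ∞) f.contDiff (by simp)).clm_apply contDiff_const⟩
  map_add' f g := Smooth.ext fun u => by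
    change fderiv ℝ (fun v => f v + g v) u (Pi.single i 1) =
      fderiv ℝ (fun v => f v) u (Pi.single i 1) + fderiv ℝ (fun v => g v) u (Pi.single i 1)
    rw [fderiv_fun_add (f.differentiableAt u) (g.differentiableAt u)]
    rfl
  map_smul' c f := Smooth.ext fun u => by
    change fderiv ℝ (fun v => c • f v) u (Pi.single i 1) =
      c • fderiv ℝ (fun v => f v) u (Pi.single i 1)
    rw [fderiv_fun_const_smul (f.differentiableAt u)]
    rfl

/-- The coordinate function `uᵢ`. -/
def coord {n : ℕ} (i : Fin n) : Smooth n :=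
  ⟨fun u => ((u i : ℝ) : ℂ), show ContDiff ℝ ∞ fun u : Fin n → ℝ => ((u i : ℝ) : ℂ) from
    Complex.ofRealCLM.contDiff.comp (contDiff_apply ℝ ℝ i)⟩

/-- Multiplication by a smooth function, as an operator. -/
def mulOp {n : ℕ} (f : Smooth n) : Module.End ℂ (Smooth n) := LinearMap.mulLeft ℂ f

/-- Smooth functions on `T*ℝⁿ`, polynomial along the fibres: polynomials in the conjugate momenta
`ξ₁, …, ξₙ` (the variables `X i`) whose coefficients are smooth functions of `u`. -/
abbrev Pol (n : ℕ) : Type := MvPolynomial (Fin n) (Smooth n)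

/-- Applying a family of linear maps to the coefficients of an element of `Pol n`:
`Σ fₐ ξᵃ ↦ Σ (L a fₐ) ξᵃ`. -/
def onCoeff {n : ℕ} (L : (Fin n →₀ ℕ) → Module.End ℂ (Smooth n)) : Module.End ℂ (Pol n) where
  toFun p := ∑ a ∈ p.support, MvPolynomial.monomial a (L a (p.coeff a))
  map_add' p q := by
    classical
    ext1 b
    simp only [MvPolynomial.coeff_sum, MvPolynomial.coeff_monomial, MvPolynomial.coeff_add,
      Finset.sum_ite_eq', MvPolynomial.mem_support_iff]
    split_ifs <;> simp_all [← map_add]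
  map_smul' c p := by
    classical
    ext1 b
    simp only [MvPolynomial.coeff_sum, MvPolynomial.coeff_monomial, MvPolynomial.coeff_smul,
      Finset.sum_ite_eq', MvPolynomial.mem_support_iff, RingHom.id_apply]
    split_ifs <;> simp_all

theorem coeff_onCoeff {n : ℕ} (L : (Fin n →₀ ℕ) → Module.End ℂ (Smooth n)) (p : Pol n)
    (b : Fin n →₀ ℕ) : (onCoeff L p).coeff b = L b (p.coeff b) := by
  classical
  simp only [onCoeff, LinearMap.coe_mk, AddHom.coe_mk, MvPolynomial.coeff_sum,
    MvPolynomial.coeff_monomial, Finset.sum_ite_eq', MvPolynomial.mem_support_iff]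
  split_ifs <;> simp_all

/-- `∂/∂uᵢ` on `Pol n`. -/
def dU {n : ℕ} (i : Fin n) : Module.End ℂ (Pol n) := onCoeff fun _ => pd i

/-- `∂/∂ξᵢ` on `Pol n`. -/
def dXi {n : ℕ} (i : Fin n) : Module.End ℂ (Pol n) :=
  (MvPolynomial.pderiv (R := Smooth n) i).toLinearMap.restrictScalars ℂ

/-- The fibrewise Euler vector field `E = Σ ξᵢ ∂/∂ξᵢ`. -/
def euler (n : ℕ) : Module.End ℂ (Pol n) :=
  ∑ i, LinearMap.mulLeft ℂ (MvPolynomial.X i : Pol n) * dXi i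

/-- `D = Σ ∂²/∂uᵢ∂ξᵢ`. -/
def opD (n : ℕ) : Module.End ℂ (Pol n) := ∑ i, dU i * dXi i

/-- The Poisson bracket, normalised by `{ξᵢ, uⱼ} = δᵢⱼ`. -/
def poisson {n : ℕ} (p q : Pol n) : Pol n := ∑ i, (dXi i p * dU i q - dU i p * dXi i q)

/-- The algebra of smooth linear differential operators on `λ`-densities on `ℝⁿ`. A `λ`-density
`f |du₁⋯duₙ|^λ` is identified with the function `f`, so that differential operators on
`λ`-densities are those on functions; the parameter `λ` enters through the Lie derivative
`lieDensity`. -/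
def DiffOp (n : ℕ) : Subalgebra ℂ (Module.End ℂ (Smooth n)) :=
  Algebra.adjoin ℂ (Set.range mulOp ∪ Set.range pd)

/-- The operator `∂ᵃ = ∂₁^{a₁} ⋯ ∂ₙ^{aₙ}`. -/
def pdPow {n : ℕ} (a : Fin n →₀ ℕ) : Module.End ℂ (Smooth n) :=
  (List.ofFn fun i => pd i ^ a i).prod

/-- The differential operator `Σ fₐ ∂ᵃ` with full symbol `Σ fₐ ξᵃ`. -/
def ofFullSymbol {n : ℕ} (p : Pol n) : Module.End ℂ (Smooth n) :=
  ∑ a ∈ p.support, mulOp (p.coeff a) * pdPow a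

/-- `T` is a differential operator of order at most `d`, and its principal symbol (the part of its
full symbol that is homogeneous of degree `d`) is `φ`. -/
def HasPrincipalSymbol {n : ℕ} (d : ℕ) (T : Module.End ℂ (Smooth n)) (φ : Pol n) : Prop :=
  φ.IsHomogeneous d ∧ ∃ r : Pol n, (∀ a ∈ r.support, a.degree < d) ∧ T = ofFullSymbol (φ + r)

/-- The homogeneous coordinates `(u₀, u₁, …, uₙ)` on the big cell `u₀ = 1`. -/
def homCoord (n : ℕ) : Fin (n + 1) → Smooth n := Fin.cons 1 coord

/-- The components of the linear vector field `x · (u₀, …, uₙ)ᵀ` along the big cell. -/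
def linComp {n : ℕ} (x : Matrix (Fin (n + 1)) (Fin (n + 1)) ℝ) (k : Fin (n + 1)) : Smooth n :=
  ∑ j, (x k j : ℂ) • homCoord n j

/-- The `i`-th component (the coefficient of `∂/∂uᵢ`) of the vector field `ηˣ` on the big cell that
is induced by the action of `x` on projective space: the derivative at `s = 0` of the `i`-th affine
coordinate of `exp (s x) · [1, u₁, …, uₙ]`. -/
def vf {n : ℕ} (x : Matrix (Fin (n + 1)) (Fin (n + 1)) ℝ) (i : Fin n) : Smooth n :=
  linComp x i.succ - coord i * linComp x 0

/-- The momentum function `μˣ = Σ ηˣᵢ ξᵢ`, the principal symbol of `ηˣ`. -/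
def momentum {n : ℕ} (x : Matrix (Fin (n + 1)) (Fin (n + 1)) ℝ) : Pol n :=
  ∑ i, MvPolynomial.C (vf x i) * MvPolynomial.X i

/-- The Lie derivative of `λ`-densities along `ηˣ`, which is `Σ ηˣᵢ ∂ᵢ + λ div ηˣ`. -/
def lieDensity {n : ℕ} (lam : ℂ) (x : Matrix (Fin (n + 1)) (Fin (n + 1)) ℝ) :
    Module.End ℂ (Smooth n) :=
  ∑ i, mulOp (vf x i) * pd i + lam • mulOp (∑ i, pd i (vf x i))

/-- `Q` is an `sl(n+1, ℝ)`-equivariant quantization map from `Pol n` to differential operators on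
`λ`-densities: a linear isomorphism (this is in the type of `Q`) that respects principal symbols
and intertwines the actions of `sl(n+1, ℝ)`. -/
structure IsEquivariantQuantization {n : ℕ} (lam : ℂ) (Q : Pol n ≃ₗ[ℂ] DiffOp n) : Prop where
  symbol : ∀ (d : ℕ) (φ : Pol n), φ.IsHomogeneous d →
    HasPrincipalSymbol d (Q φ : Module.End ℂ (Smooth n)) φ
  equivariant : ∀ (x : LieAlgebra.SpecialLinear.sl (Fin (n + 1)) ℝ) (φ : Pol n),
    (Q (poisson (momentum (x : Matrix (Fin (n + 1)) (Fin (n + 1)) ℝ)) φ) :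
        Module.End ℂ (Smooth n)) =
      lieDensity lam (x : Matrix (Fin (n + 1)) (Fin (n + 1)) ℝ) * (Q φ : Module.End ℂ (Smooth n)) -
        (Q φ : Module.End ℂ (Smooth n)) *
          lieDensity lam (x : Matrix (Fin (n + 1)) (Fin (n + 1)) ℝ)

/-- The `ℂ[t]`-linear extension of the map with `φ ↦ tᵈ Q(φ)` for `φ` homogeneous of degree `d`. -/
def quantT {n : ℕ} (Q : Pol n ≃ₗ[ℂ] DiffOp n) (P : (Pol n)[X]) : (DiffOp n)[X] :=
  P.sum fun m φ => ∑ d ∈ Finset.range (φ.totalDegree + 1),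
    Polynomial.monomial (d + m) (Q (MvPolynomial.homogeneousComponent d φ))

/-- The star product `Q_t⁻¹ (Q_t(Φ) Q_t(Ψ))` on `(Pol n)[t]`. -/
def star {n : ℕ} (Q : Pol n ≃ₗ[ℂ] DiffOp n) (Φ Ψ : (Pol n)[X]) : (Pol n)[X] :=
  Function.invFun (quantT Q) (quantT Q Φ * quantT Q Ψ)

theorem coeff_euler {n : ℕ} (p : Pol n) (b : Fin n →₀ ℕ) :
    (euler n p).coeff b = (b.degree : ℂ) • p.coeff b := by
  classical
  induction p using MvPolynomial.induction_on' with
  | add p q hp hq => rw [map_add, MvPolynomial.coeff_add, hp, hq, MvPolynomial.coeff_add, smul_add]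
  | monomial a f =>
    have h : euler n (MvPolynomial.monomial a f) = (a.degree : ℂ) • MvPolynomial.monomial a f := by
      have h1 : euler n (MvPolynomial.monomial a f) =
          ∑ i, MvPolynomial.X i * MvPolynomial.pderiv i (MvPolynomial.monomial a f) := by
        simp [euler, dXi]
      rw [h1, (MvPolynomial.isHomogeneous_monomial f rfl).sum_X_mul_pderiv, Nat.cast_smul_eq_nsmul]
    rw [h, MvPolynomial.coeff_smul, MvPolynomial.coeff_monomial]
    split_ifs with hab
    · rw [hab]
    · simp

/-- The operator `2E + j + n + 1`. -/
def den (n j : ℕ) : Module.End ℂ (Pol n) :=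
  (2 : ℂ) • euler n + ((j : ℂ) + n + 1) • (1 : Module.End ℂ (Pol n))

theorem coeff_den {n : ℕ} (j : ℕ) (p : Pol n) (b : Fin n →₀ ℕ) :
    (den n j p).coeff b = (2 * (b.degree : ℂ) + (j + n + 1)) • p.coeff b := by
  simp [den, coeff_euler, add_smul, mul_smul]

/-- The operator `2E + j + n + 1` is invertible. -/
theorem isUnit_den (n j : ℕ) : IsUnit (den n j) := by
  have hne : ∀ b : Fin n →₀ ℕ, (2 * (b.degree : ℂ) + (j + n + 1)) ≠ 0 := fun b => by
    have : ((2 * b.degree + (j + n + 1) : ℕ) : ℂ) ≠ 0 := Nat.cast_ne_zero.2 (by omega)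
    exact_mod_cast this
  let inv : Module.End ℂ (Pol n) :=
    onCoeff fun b => (2 * (b.degree : ℂ) + (j + n + 1))⁻¹ • (1 : Module.End ℂ (Smooth n))
  refine ⟨⟨den n j, inv, ?_, ?_⟩, rfl⟩
  · refine LinearMap.ext fun p => MvPolynomial.ext _ _ fun b => ?_
    simp [inv, coeff_den, coeff_onCoeff, smul_smul, mul_inv_cancel₀ (hne b)]
  · refine LinearMap.ext fun p => MvPolynomial.ext _ _ fun b => ?_
    simp [inv, coeff_den, coeff_onCoeff, smul_smul, mul_inv_cancel₀ (hne b)]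

/-- The operator `g_{λ,d} = (1/d!) ∏_{j<d} (-E - j - λ(n+1)) / (2E + j + n + 1)`; all the factors
commute with each other. -/
def gCoeff (n : ℕ) (lam : ℂ) (d : ℕ) : Module.End ℂ (Pol n) :=
  ((d.factorial : ℂ)⁻¹) • ((List.range d).map fun j : ℕ =>
    (-euler n - ((j : ℂ) + lam * (n + 1)) • (1 : Module.End ℂ (Pol n))) *
      (↑(isUnit_den n j).unit⁻¹ : Module.End ℂ (Pol n))).prod

/-- `g_λ = 1 + Σ_{d ≥ 1} g_{λ,d} Dᵈ tᵈ`. The sum may be cut at the fibre degree of the argument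
since `D` lowers that degree. -/
def gOp {n : ℕ} (lam : ℂ) (φ : Pol n) : (Pol n)[X] :=
  Polynomial.C φ + ∑ d ∈ Finset.Icc 1 φ.totalDegree,
    Polynomial.monomial d (gCoeff n lam d ((opD n ^ d) φ))

/-- A polynomial in `ξ` with constant coefficients, as an element of `Pol n`. -/
def fibrePoly {n : ℕ} (ψ : MvPolynomial (Fin n) ℂ) : Pol n :=
  MvPolynomial.map (algebraMap ℂ (Smooth n)) ψ

end ProjStar

end

/-!
Normal ordering `Σ fₐ ξᵃ ↦ Σ fₐ ∂ᵃ` is not `sl(n+1)`-equivariant: conjugating the commutator with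
the Lie derivative of `ηˣ` back to symbols gives the Poisson bracket with `μˣ` plus a term lowering
the fibre degree, which comes from the second derivatives of `ηˣ`. The operator `g_λ` at `t = 1`
intertwines the two actions, so normal ordering after its inverse is an equivariant quantization.
It is the only one, since the Casimir element of `gl(n+1)` acts on symbols of degree `d` by
`2d(d + n)`; these numbers are distinct, so an equivariant map preserves the grading, and one that
also preserves principal symbols is the identity. Up to powers of `t`, applying the quantization to
`g_λ(p)` therefore gives the normal ordering of `p`, and normal ordering of `φ ψ` is multiplication
by `φ` after normal ordering of `ψ`.
-/

noncomputable section

namespace ProjStar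

open MvPolynomial (X C coeff monomial homogeneousComponent)

variable {n : ℕ}

theorem pd_mul (i : Fin n) (f g : Smooth n) : pd i (f * g) = pd i f * g + f * pd i g :=
  Smooth.ext fun u => by
    change fderiv ℝ (fun v => f v * g v) u (Pi.single i 1) =
      fderiv ℝ (fun v => f v) u (Pi.single i 1) * g u +
        f u * fderiv ℝ (fun v => g v) u (Pi.single i 1)
    rw [fderiv_fun_mul (f.differentiableAt u) (g.differentiableAt u)]
    simp only [add_apply, smul_apply, smul_eq_mul]
    ring

theorem pd_one (i : Fin n) : pd i (1 : Smooth n) = 0 := by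
  simpa using pd_mul i (1 : Smooth n) 1

theorem pd_coord (i j : Fin n) : pd i (coord j) = if i = j then 1 else 0 :=
  Smooth.ext fun u => by
    have hcoord : HasFDerivAt (fun v : Fin n → ℝ => ((v j : ℝ) : ℂ))
        (Complex.ofRealCLM.comp (ContinuousLinearMap.proj j)) u :=
      (Complex.ofRealCLM.comp (.proj (R := ℝ) (φ := fun _ : Fin n => ℝ) j)).hasFDerivAt
    change fderiv ℝ (fun v : Fin n → ℝ => ((v j : ℝ) : ℂ)) u (Pi.single i 1) = _
    rw [hcoord.fderiv, ContinuousLinearMap.comp_apply, ContinuousLinearMap.proj_apply,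
      Pi.single_apply]
    simp only [eq_comm (a := j)]
    split_ifs
    · exact Complex.ofReal_one
    · exact Complex.ofReal_zero

theorem pd_pd_apply (i j : Fin n) (f : Smooth n) (u : Fin n → ℝ) :
    pd i (pd j f) u = fderiv ℝ (fderiv ℝ fun v => f v) u (Pi.single i 1) (Pi.single j 1) := by
  have hf : DifferentiableAt ℝ (fderiv ℝ fun v => f v) u :=
    (ContDiff.fderiv_right (m := ∞) f.contDiff (by simp)).differentiable (by simp) u
  change fderiv ℝ (fun v => fderiv ℝ (fun w => f w) v (Pi.single j 1)) u (Pi.single i 1) = _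
  rw [fderiv_clm_apply hf (differentiableAt_const _)]
  simp

theorem pd_commute (i j : Fin n) : Commute (pd i) (pd j) :=
  LinearMap.ext fun f => Smooth.ext fun u => by
    change pd i (pd j f) u = pd j (pd i f) u
    rw [pd_pd_apply, pd_pd_apply]
    exact (f.contDiff.contDiffAt.isSymmSndFDerivAt
      (by simpa using WithTop.coe_le_coe.2 (le_top : (2 : ℕ∞) ≤ ⊤))).eq _ _

theorem pd_pd_comm (i j : Fin n) (f : Smooth n) : pd i (pd j f) = pd j (pd i f) :=
  LinearMap.congr_fun (pd_commute i j).eq f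

theorem mulOp_eq_lmul (f : Smooth n) : mulOp f = Algebra.lmul ℂ (Smooth n) f := rfl

theorem pd_mul_mulOp (i : Fin n) (f : Smooth n) :
    pd i * mulOp f = mulOp f * pd i + mulOp (pd i f) :=
  LinearMap.ext fun g => (pd_mul i f g).trans (add_comm _ _)

theorem coeff_dU (i : Fin n) (p : Pol n) (b : Fin n →₀ ℕ) :
    coeff b (dU i p) = pd i (coeff b p) := coeff_onCoeff _ _ _

theorem dU_monomial (i : Fin n) (a : Fin n →₀ ℕ) (f : Smooth n) :
    dU i (monomial a f) = monomial a (pd i f) := by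
  classical
  ext1 b
  rw [coeff_dU, MvPolynomial.coeff_monomial, MvPolynomial.coeff_monomial]
  split_ifs <;> simp

theorem dU_C (i : Fin n) (f : Smooth n) : dU i (C f) = C (pd i f) := dU_monomial i 0 f

theorem dU_X (i j : Fin n) : dU i (X j : Pol n) = 0 := by
  rw [MvPolynomial.X, dU_monomial, pd_one, MvPolynomial.monomial_zero]

theorem dU_mul (i : Fin n) (p q : Pol n) : dU i (p * q) = dU i p * q + p * dU i q := by
  induction p using MvPolynomial.induction_on' with
  | add p p' hp hp' => simp only [add_mul, map_add, hp, hp']; ring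
  | monomial a f =>
    induction q using MvPolynomial.induction_on' with
    | add q q' hq hq' => simp only [mul_add, map_add, hq, hq']; ring
    | monomial b g => simp only [MvPolynomial.monomial_mul, dU_monomial, pd_mul, map_add]

theorem coeff_dXi (i : Fin n) (p : Pol n) (b : Fin n →₀ ℕ) :
    coeff b (dXi i p) = ((b i + 1 : ℕ) : ℂ) • coeff (b + Finsupp.single i 1) p := by
  rw [Nat.cast_smul_eq_nsmul, nsmul_eq_mul, mul_comm, Nat.cast_succ]
  exact MvPolynomial.coeff_pderiv ..

theorem dXi_mul (i : Fin n) (p q : Pol n) : dXi i (p * q) = dXi i p * q + p * dXi i q :=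
  MvPolynomial.pderiv_mul

theorem dXi_C (i : Fin n) (f : Smooth n) : dXi i (C f) = 0 := MvPolynomial.pderiv_C

theorem dXi_X (i j : Fin n) : dXi i (X j : Pol n) = if i = j then 1 else 0 := by
  classical
  exact (MvPolynomial.pderiv_X i j).trans (Pi.single_apply i _ j |>.trans (by simp only [eq_comm]))

theorem dU_dU_comm (i j : Fin n) (p : Pol n) : dU i (dU j p) = dU j (dU i p) := by
  ext1 b
  simp only [coeff_dU, pd_pd_comm i j]

theorem dXi_dU_comm (i j : Fin n) (p : Pol n) : dXi i (dU j p) = dU j (dXi i p) := by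
  ext1 b
  simp only [coeff_dU, coeff_dXi, map_smul]

theorem dXi_dXi_comm (i j : Fin n) (p : Pol n) : dXi i (dXi j p) = dXi j (dXi i p) := by
  ext1 b
  simp only [coeff_dXi, smul_smul, ← Nat.cast_mul, add_right_comm b]
  rcases eq_or_ne i j with rfl | hij
  · rfl
  · simp only [Finsupp.add_apply, Finsupp.single_eq_of_ne hij, Finsupp.single_eq_of_ne hij.symm,
      add_zero, mul_comm (b i + 1)]

theorem euler_apply (p : Pol n) : euler n p = ∑ i, X i * dXi i p := by
  simp [euler]

theorem euler_C (f : Smooth n) : euler n (C f) = 0 := by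
  simp only [euler_apply, dXi_C, mul_zero, Finset.sum_const_zero]

theorem euler_X (i : Fin n) : euler n (X i) = X i := by
  simp only [euler_apply, dXi_X, mul_ite, mul_one, mul_zero, Finset.sum_ite_eq', Finset.mem_univ,
    if_true]

theorem euler_mul (p q : Pol n) : euler n (p * q) = euler n p * q + p * euler n q := by
  simp only [euler_apply, dXi_mul, Finset.sum_mul, Finset.mul_sum, ← Finset.sum_add_distrib]
  exact Finset.sum_congr rfl fun i _ => by ring

theorem euler_dU (i : Fin n) (p : Pol n) : euler n (dU i p) = dU i (euler n p) := by
  ext1 b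
  simp only [coeff_euler, coeff_dU, map_smul]

theorem dXi_euler (i : Fin n) (p : Pol n) : dXi i (euler n p) = euler n (dXi i p) + dXi i p := by
  ext1 b
  simp only [MvPolynomial.coeff_add, coeff_euler, coeff_dXi, map_add, Finsupp.degree_single,
    Nat.cast_add, Nat.cast_one, add_smul, smul_add, one_smul, smul_comm (b.degree : ℂ)]

theorem opD_apply (p : Pol n) : opD n p = ∑ i, dU i (dXi i p) := by
  simp [opD]

theorem opD_C (f : Smooth n) : opD n (C f) = 0 := by
  simp only [opD_apply, dXi_C, map_zero, Finset.sum_const_zero]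

theorem opD_euler (p : Pol n) : opD n (euler n p) = euler n (opD n p) + opD n p := by
  simp only [opD_apply, dXi_euler, map_add, map_sum, euler_dU, Finset.sum_add_distrib]

theorem opD_dU (i : Fin n) (p : Pol n) : opD n (dU i p) = dU i (opD n p) := by
  simp only [opD_apply, map_sum, dXi_dU_comm, dU_dU_comm i]

theorem opD_dXi (i : Fin n) (p : Pol n) : opD n (dXi i p) = dXi i (opD n p) := by
  simp only [opD_apply, map_sum, dXi_dU_comm, dXi_dXi_comm i]

theorem opD_mul (p q : Pol n) :
    opD n (p * q) = opD n p * q + p * opD n q +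
      ∑ j, (dU j p * dXi j q + dXi j p * dU j q) := by
  simp only [opD_apply, dXi_mul, dU_mul, map_add, Finset.sum_mul, Finset.mul_sum,
    ← Finset.sum_add_distrib]
  exact Finset.sum_congr rfl fun i _ => by ring

/-- The Poisson bracket as a bilinear map. -/
def poissonₗ (n : ℕ) : Pol n →ₗ[ℂ] Module.End ℂ (Pol n) :=
  LinearMap.mk₂ ℂ poisson
    (fun p p' q => by
      simp only [poisson, map_add, add_mul, ← Finset.sum_add_distrib, add_sub_add_comm])
    (fun c p q => by simp only [poisson, map_smul, smul_mul_assoc, ← smul_sub, Finset.smul_sum])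
    (fun p q q' => by
      simp only [poisson, map_add, mul_add, ← Finset.sum_add_distrib, add_sub_add_comm])
    (fun c p q => by simp only [poisson, map_smul, mul_smul_comm, ← smul_sub, Finset.smul_sum])

theorem poissonₗ_apply (p q : Pol n) :
    poissonₗ n p q = ∑ i, (dXi i p * dU i q - dU i p * dXi i q) := rfl

theorem poisson_mul_left (p p' q : Pol n) :
    poissonₗ n (p * p') q = p * poissonₗ n p' q + poissonₗ n p q * p' := by
  simp only [poissonₗ_apply, dXi_mul, dU_mul, Finset.mul_sum, Finset.sum_mul,
    ← Finset.sum_add_distrib]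
  exact Finset.sum_congr rfl fun i _ => by ring

theorem poisson_mul_right (p q q' : Pol n) :
    poissonₗ n p (q * q') = poissonₗ n p q * q' + q * poissonₗ n p q' := by
  simp only [poissonₗ_apply, dXi_mul, dU_mul, Finset.mul_sum, Finset.sum_mul,
    ← Finset.sum_add_distrib]
  exact Finset.sum_congr rfl fun i _ => by ring

theorem poisson_C_left (f : Smooth n) (q : Pol n) :
    poissonₗ n (C f) q = -∑ i, C (pd i f) * dXi i q := by
  simp only [poissonₗ_apply, dXi_C, dU_C, zero_mul, zero_sub, Finset.sum_neg_distrib]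

theorem poisson_one_right (p : Pol n) : poissonₗ n p 1 = 0 := by
  simpa only [one_mul, mul_one, left_eq_add] using poisson_mul_right p 1 1

theorem poisson_X_left (i : Fin n) (q : Pol n) : poissonₗ n (X i) q = dU i q := by
  simp only [poissonₗ_apply, dXi_X, dU_X, ite_mul, one_mul, zero_mul, sub_zero, Finset.sum_ite_eq',
    Finset.mem_univ, if_true]

theorem euler_poisson (p q : Pol n) :
    euler n (poissonₗ n p q) =
      poissonₗ n (euler n p) q + poissonₗ n p (euler n q) - poissonₗ n p q := by
  simp only [poissonₗ_apply, map_sum, map_sub, euler_mul, euler_dU, dXi_euler,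
    ← Finset.sum_add_distrib, ← Finset.sum_sub_distrib]
  exact Finset.sum_congr rfl fun i _ => by ring

/-- The contraction of the base Hessian of `p` with the fibre Hessian of `q`, which measures both
the failure of `D` to be a derivation of the Poisson bracket and the second-order term in the
composition of differential operators. -/
def hessPairing (n : ℕ) : Pol n →ₗ[ℂ] Module.End ℂ (Pol n) :=
  ∑ i, ∑ j, (LinearMap.mul ℂ (Pol n)).compl₁₂ (dU i * dU j) (dXi i * dXi j)

theorem hessPairing_apply (p q : Pol n) :
    hessPairing n p q = ∑ i, ∑ j, dU i (dU j p) * dXi i (dXi j q) := by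
  simp [hessPairing]

theorem opD_poisson (p q : Pol n) :
    opD n (poissonₗ n p q) = poissonₗ n (opD n p) q + poissonₗ n p (opD n q) +
      hessPairing n q p - hessPairing n p q := by
  have hmixed : ∑ i, ∑ j, dU j (dXi i p) * dU i (dXi j q) =
      ∑ i, ∑ j, dU i (dXi j p) * dU j (dXi i q) := Finset.sum_comm
  have hcross : ∑ i, ∑ j, (dU j (dXi i p) * dXi j (dU i q) + dXi j (dXi i p) * dU j (dU i q) -
      (dU j (dU i p) * dXi j (dXi i q) + dXi j (dU i p) * dU j (dXi i q))) =
      hessPairing n q p - hessPairing n p q := by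
    simp only [hessPairing_apply, dXi_dU_comm, Finset.sum_sub_distrib, Finset.sum_add_distrib,
      hmixed, mul_comm (dXi _ (dXi _ p)), fun i j => dU_dU_comm j i, fun i j => dXi_dXi_comm j i]
    ring
  rw [add_sub_assoc, ← hcross]
  simp only [poissonₗ_apply, map_sum, map_sub, opD_mul, opD_dU, opD_dXi,
    ← Finset.sum_add_distrib]
  refine Finset.sum_congr rfl fun i _ => ?_
  rw [Finset.sum_sub_distrib]
  ring

theorem hessPairing_X_mul (k : Fin n) (p q : Pol n) :
    hessPairing n p (X k * q) = X k * hessPairing n p q + 2 * ∑ i, dU i (dU k p) * dXi i q := by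
  have hdXi (i j : Fin n) : dXi i (dXi j (X k * q)) = X k * dXi i (dXi j q) +
      ((if i = k then dXi j q else 0) + if j = k then dXi i q else 0) := by
    simp only [dXi_mul, dXi_X, map_add, ite_mul, one_mul, zero_mul, apply_ite (dXi i), map_zero]
    ring
  simp only [hessPairing_apply, hdXi, mul_add, Finset.sum_add_distrib, mul_ite, mul_zero,
    Finset.sum_ite_eq', Finset.mem_univ, if_true, Finset.sum_ite_irrel, Finset.sum_const_zero,
    dU_dU_comm k, mul_left_comm _ (X k), ← Finset.mul_sum]
  ring

section Filtration

variable {R M : Type*} [Ring R] [AddCommGroup M] [Module R M] {F : ℕ → Submodule R M}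
  {f : M →ₗ[R] M}

theorem exists_mem_eq_of_sub_mem (h0 : F 0 = ⊥) (hmono : Monotone F)
    (hf : ∀ d, ∀ x ∈ F (d + 1), f x - x ∈ F d) (d : ℕ) : ∀ x ∈ F d, ∃ y ∈ F d, f y = x := by
  induction d with
  | zero =>
    intro x hx
    rw [h0, Submodule.mem_bot] at hx
    exact ⟨0, zero_mem _, by rw [map_zero, hx]⟩
  | succ d ih =>
    intro x hx
    obtain ⟨y, hy, hfy⟩ := ih _ (hf d x hx)
    exact ⟨x - y, sub_mem hx (hmono d.le_succ hy), by rw [map_sub, hfy, sub_sub_cancel]⟩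

theorem eq_zero_of_sub_mem (h0 : F 0 = ⊥) (hf : ∀ d, ∀ x ∈ F (d + 1), f x - x ∈ F d) {d : ℕ}
    {x : M} (hx : x ∈ F d) (hfx : f x = 0) : x = 0 := by
  induction d with
  | zero => rwa [h0, Submodule.mem_bot] at hx
  | succ d ih => exact ih (by simpa only [hfx, zero_sub, neg_mem_iff] using hf d x hx)

theorem bijective_of_sub_mem (h0 : F 0 = ⊥) (hmono : Monotone F) (hF : ∀ x, ∃ d, x ∈ F d)
    (hf : ∀ d, ∀ x ∈ F (d + 1), f x - x ∈ F d) : Function.Bijective f := by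
  refine ⟨(injective_iff_map_eq_zero f).2 fun x hfx => ?_, fun x => ?_⟩
  · obtain ⟨d, hx⟩ := hF x
    exact eq_zero_of_sub_mem h0 hf hx hfx
  · obtain ⟨d, hx⟩ := hF x
    obtain ⟨y, -, hy⟩ := exists_mem_eq_of_sub_mem h0 hmono hf d x hx
    exact ⟨y, hy⟩

end Filtration

/-- The symbols of fibre degree less than `d`. -/
def degreeLT (n d : ℕ) : Submodule ℂ (Pol n) :=
  (MvPolynomial.restrictSupport (Smooth n) {a : Fin n →₀ ℕ | a.degree < d}).restrictScalars ℂ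

theorem mem_degreeLT {d : ℕ} {p : Pol n} : p ∈ degreeLT n d ↔ ∀ a ∈ p.support, a.degree < d :=
  MvPolynomial.mem_restrictSupport_iff _

theorem mem_degreeLT_iff_coeff {d : ℕ} {p : Pol n} :
    p ∈ degreeLT n d ↔ ∀ a : Fin n →₀ ℕ, d ≤ a.degree → coeff a p = 0 := by
  simp only [mem_degreeLT, MvPolynomial.mem_support_iff, ← not_le, not_imp_not]

theorem degreeLT_zero : degreeLT n 0 = ⊥ :=
  (Submodule.eq_bot_iff _).2 fun _ hp =>
    MvPolynomial.ext _ _ fun a => mem_degreeLT_iff_coeff.1 hp a (Nat.zero_le _)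

theorem degreeLT_mono : Monotone (degreeLT n) := fun _ _ hde _ hp =>
  mem_degreeLT.2 fun a ha => (mem_degreeLT.1 hp a ha).trans_le hde

theorem mem_degreeLT_totalDegree (p : Pol n) : p ∈ degreeLT n (p.totalDegree + 1) :=
  mem_degreeLT.2 fun _ ha => Nat.lt_succ_of_le (MvPolynomial.le_totalDegree ha)

theorem mem_degreeLT_of_isHomogeneous {d : ℕ} {p : Pol n} (hp : p.IsHomogeneous d) :
    p ∈ degreeLT n (d + 1) :=
  degreeLT_mono (Nat.succ_le_succ hp.totalDegree_le) (mem_degreeLT_totalDegree p)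

theorem dXi_mem_degreeLT {d : ℕ} {p : Pol n} (hp : p ∈ degreeLT n (d + 1)) (i : Fin n) :
    dXi i p ∈ degreeLT n d :=
  mem_degreeLT_iff_coeff.2 fun a ha => by
    rw [coeff_dXi, mem_degreeLT_iff_coeff.1 hp _ (by simpa using ha), smul_zero]

theorem dU_mem_degreeLT {d : ℕ} {p : Pol n} (hp : p ∈ degreeLT n d) (i : Fin n) :
    dU i p ∈ degreeLT n d :=
  mem_degreeLT_iff_coeff.2 fun a ha => by
    rw [coeff_dU, mem_degreeLT_iff_coeff.1 hp a ha, map_zero]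

theorem opD_mem_degreeLT {d : ℕ} {p : Pol n} (hp : p ∈ degreeLT n (d + 1)) :
    opD n p ∈ degreeLT n d := by
  rw [opD_apply]
  exact sum_mem fun i _ => dU_mem_degreeLT (dXi_mem_degreeLT hp i) i

theorem eq_C_of_euler_eq_zero {p : Pol n} (hp : euler n p = 0) : p = C (coeff 0 p) := by
  classical
  ext1 b
  rw [MvPolynomial.coeff_C]
  split_ifs with hb
  · rw [hb]
  · have hcoeff := coeff_euler p b
    rw [hp, MvPolynomial.coeff_zero, eq_comm, smul_eq_zero, Nat.cast_eq_zero,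
      Finsupp.degree_eq_zero_iff] at hcoeff
    exact hcoeff.resolve_left (Ne.symm hb)

theorem prod_ofFn_pow_add_single {M : Type*} [Monoid M] {m : ℕ} (f : Fin m → M)
    (hf : ∀ i j, Commute (f i) (f j)) (a : Fin m → ℕ) (i : Fin m) :
    (List.ofFn fun k => f k ^ (a k + if k = i then 1 else 0)).prod =
      (List.ofFn fun k => f k ^ a k).prod * f i := by
  induction m with
  | zero => exact i.elim0
  | succ m ih =>
    simp only [List.ofFn_succ, List.prod_cons]
    cases i using Fin.cases with
    | zero =>
      have hcomm : Commute (f 0) (List.ofFn fun k : Fin m => f k.succ ^ a k.succ).prod :=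
        Commute.list_prod_right _ _ fun x hx => by
          obtain ⟨k, rfl⟩ := List.mem_ofFn.1 hx
          exact (hf 0 k.succ).pow_right _
      simp only [Fin.succ_ne_zero, if_true, if_false, add_zero, pow_succ, mul_assoc, hcomm.eq]
    | succ i =>
      simp only [(Fin.succ_ne_zero i).symm, if_false, add_zero, Fin.succ_inj,
        ih (fun k => f k.succ) (fun _ _ => hf _ _) (fun k => a k.succ) i, mul_assoc]

theorem pdPow_add_single (a : Fin n →₀ ℕ) (i : Fin n) :
    pdPow (a + Finsupp.single i 1) = pdPow a * pd i := by
  classical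
  rw [pdPow, pdPow, ← prod_ofFn_pow_add_single _ pd_commute]
  simp only [Finsupp.add_apply, Finsupp.single_apply, eq_comm]

/-- Normal ordering `Σ fₐ ξᵃ ↦ Σ fₐ ∂ᵃ` as a linear map. -/
def fullSymbolMap (n : ℕ) : Pol n →ₗ[ℂ] Module.End ℂ (Smooth n) where
  toFun := ofFullSymbol
  map_add' p q :=
    Finsupp.sum_add_index' (h := fun a f => mulOp f * pdPow a)
      (fun a => by rw [mulOp_eq_lmul, map_zero, zero_mul])
      fun a f g => by simp only [mulOp_eq_lmul, map_add, add_mul]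
  map_smul' c p := by
    refine (Finset.sum_subset MvPolynomial.support_smul fun a _ ha => ?_).trans ?_
    · rw [MvPolynomial.notMem_support_iff.1 ha, mulOp_eq_lmul, map_zero, zero_mul]
    · simp only [ofFullSymbol, RingHom.id_apply, Finset.smul_sum, MvPolynomial.coeff_smul,
        mulOp_eq_lmul, map_smul, smul_mul_assoc]

theorem fullSymbolMap_monomial (a : Fin n →₀ ℕ) (f : Smooth n) :
    fullSymbolMap n (monomial a f) = mulOp f * pdPow a :=
  Finsupp.sum_single_index (h := fun a f => mulOp f * pdPow a)
    (by rw [mulOp_eq_lmul, map_zero, zero_mul])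

theorem fullSymbolMap_C (f : Smooth n) : fullSymbolMap n (C f) = mulOp f :=
  (fullSymbolMap_monomial 0 f).trans (by simp [pdPow, List.prod_eq_one])

theorem fullSymbolMap_one : fullSymbolMap n 1 = 1 := by
  rw [← MvPolynomial.C_1, fullSymbolMap_C, mulOp_eq_lmul, map_one]

theorem fullSymbolMap_C_mul (f : Smooth n) (p : Pol n) :
    fullSymbolMap n (C f * p) = mulOp f * fullSymbolMap n p := by
  induction p using MvPolynomial.induction_on' with
  | add p q hp hq => simp only [mul_add, map_add, hp, hq]
  | monomial a g =>
    simp only [MvPolynomial.C_mul_monomial, fullSymbolMap_monomial, mulOp_eq_lmul, map_mul,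
      mul_assoc]

theorem fullSymbolMap_X_mul (i : Fin n) (p : Pol n) :
    fullSymbolMap n (X i * p) = fullSymbolMap n p * pd i := by
  induction p using MvPolynomial.induction_on' with
  | add p q hp hq => simp only [mul_add, add_mul, map_add, hp, hq]
  | monomial a g =>
    rw [mul_comm, MvPolynomial.X, MvPolynomial.monomial_mul, mul_one, fullSymbolMap_monomial,
      fullSymbolMap_monomial, pdPow_add_single, mul_assoc]

theorem pd_mul_fullSymbolMap (i : Fin n) (p : Pol n) :
    pd i * fullSymbolMap n p = fullSymbolMap n (X i * p + dU i p) := by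
  induction p using MvPolynomial.induction_on with
  | C f => rw [map_add, fullSymbolMap_X_mul, dU_C, fullSymbolMap_C, fullSymbolMap_C, pd_mul_mulOp]
  | add p q hp hq => simp only [mul_add, map_add, hp, hq]; abel
  | mul_X p k hp =>
    rw [mul_comm p, fullSymbolMap_X_mul, ← mul_assoc, hp, ← fullSymbolMap_X_mul, dU_mul, dU_X,
      zero_mul, zero_add, mul_add, mul_left_comm]

theorem hessPairing_C_eq_zero {f : Smooth n} (hf : ∀ i j, pd i (pd j f) = 0) (p : Pol n) :
    hessPairing n (C f) p = 0 := by
  simp only [hessPairing_apply, dU_C, hf, map_zero, zero_mul, Finset.sum_const_zero]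

/- The Leibniz expansion of `∂ᵃ ∘ f` stops at the second derivatives of `f`. -/
theorem fullSymbolMap_mul_mulOp {f : Smooth n} (hf : ∀ i j k, pd i (pd j (pd k f)) = 0)
    (p : Pol n) : fullSymbolMap n p * mulOp f =
      fullSymbolMap n (C f * p - poissonₗ n (C f) p + (1 / 2 : ℂ) • hessPairing n (C f) p) := by
  induction p using MvPolynomial.induction_on generalizing f with
  | C g =>
    have hpoisson : poissonₗ n (C f) (C g) = 0 := by
      simp only [poisson_C_left, dXi_C, mul_zero, Finset.sum_const_zero, neg_zero]
    have hhess : hessPairing n (C f) (C g) = 0 := by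
      simp only [hessPairing_apply, dXi_C, map_zero, mul_zero, Finset.sum_const_zero]
    rw [hpoisson, hhess, smul_zero, sub_zero, add_zero, mul_comm, fullSymbolMap_C_mul,
      fullSymbolMap_C, fullSymbolMap_C]
  | add p q hp hq =>
    rw [map_add, add_mul, hp hf, hq hf, ← map_add]
    congr 1
    simp only [mul_add, map_add, smul_add]
    abel
  | mul_X p k hp =>
    have hpoisson : poissonₗ n (C f) (X k * p) = X k * poissonₗ n (C f) p - C (pd k f) * p := by
      rw [poisson_mul_right, poisson_C_left, poisson_C_left]
      simp only [dXi_X, mul_ite, mul_one, mul_zero, Finset.sum_ite_eq', Finset.mem_univ, if_true]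
      ring
    have hhess : hessPairing n (C f) (X k * p) =
        X k * hessPairing n (C f) p - (2 : ℂ) • poissonₗ n (C (pd k f)) p := by
      rw [hessPairing_X_mul, poisson_C_left, smul_neg, sub_neg_eq_add, two_smul, two_mul]
      simp only [dU_C]
    rw [mul_comm p, fullSymbolMap_X_mul, mul_assoc, pd_mul_mulOp, mul_add, ← mul_assoc, hp hf,
      hp fun i j l => by rw [hf, map_zero], ← fullSymbolMap_X_mul, ← map_add,
      hessPairing_C_eq_zero fun i j => hf i j k, hpoisson, hhess]
    congr 1
    rw [smul_zero, add_zero, smul_sub, smul_smul, one_div_mul_cancel two_ne_zero, one_smul,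
      mul_add, mul_sub, mul_smul_comm]
    ring

theorem fullSymbolMap_dXi (i : Fin n) (p : Pol n) : fullSymbolMap n (dXi i p) =
    fullSymbolMap n p * mulOp (coord i) - mulOp (coord i) * fullSymbolMap n p := by
  have hpd (j k : Fin n) : pd j (pd k (coord i)) = 0 := by
    rw [pd_coord]
    split_ifs <;> simp only [pd_one, map_zero]
  rw [fullSymbolMap_mul_mulOp fun j k l => by rw [hpd, map_zero], hessPairing_C_eq_zero hpd,
    ← fullSymbolMap_C_mul, ← map_sub, poisson_C_left]
  simp only [pd_coord, apply_ite (C : Smooth n →+* Pol n), map_one, map_zero, ite_mul, one_mul,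
    zero_mul, Finset.sum_ite_eq', Finset.mem_univ, if_true]
  congr 1
  simp

theorem fullSymbolMap_injective : Function.Injective (fullSymbolMap n) := by
  refine (injective_iff_map_eq_zero _).2 fun p hp => ?_
  obtain ⟨d, hpd⟩ : ∃ d, p ∈ degreeLT n d := ⟨_, mem_degreeLT_totalDegree p⟩
  induction d generalizing p with
  | zero => rwa [degreeLT_zero, Submodule.mem_bot] at hpd
  | succ d ih =>
    have hdXi (i : Fin n) : dXi i p = 0 :=
      ih _ (by rw [fullSymbolMap_dXi, hp, zero_mul, mul_zero, sub_zero]) (dXi_mem_degreeLT hpd i)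
    have hconst : p = C (coeff 0 p) := eq_C_of_euler_eq_zero (by simp [euler_apply, hdXi])
    rw [hconst, fullSymbolMap_C] at hp
    rw [hconst, ← mul_one (coeff 0 p), show coeff 0 p * 1 = 0 from LinearMap.congr_fun hp 1,
      map_zero]

theorem mulOp_mem_diffOp (f : Smooth n) : mulOp f ∈ DiffOp n :=
  Algebra.subset_adjoin (Or.inl ⟨f, rfl⟩)

theorem pd_mem_diffOp (i : Fin n) : pd i ∈ DiffOp n :=
  Algebra.subset_adjoin (Or.inr ⟨i, rfl⟩)

theorem fullSymbolMap_mem_diffOp (p : Pol n) : fullSymbolMap n p ∈ DiffOp n := by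
  induction p using MvPolynomial.induction_on with
  | C f => rw [fullSymbolMap_C]; exact mulOp_mem_diffOp f
  | add p q hp hq => rw [map_add]; exact add_mem hp hq
  | mul_X p k hp => rw [mul_comm, fullSymbolMap_X_mul]; exact mul_mem hp (pd_mem_diffOp k)

theorem exists_fullSymbolMap_eq_mul {T : Module.End ℂ (Smooth n)} (hT : T ∈ DiffOp n)
    (p : Pol n) : ∃ q : Pol n, fullSymbolMap n q = T * fullSymbolMap n p := by
  induction hT using Algebra.adjoin_induction generalizing p with
  | mem T hT =>
    rcases hT with ⟨f, rfl⟩ | ⟨i, rfl⟩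
    · exact ⟨_, fullSymbolMap_C_mul f p⟩
    · exact ⟨_, (pd_mul_fullSymbolMap i p).symm⟩
  | algebraMap c => exact ⟨c • p, by rw [map_smul, ← Algebra.smul_def]⟩
  | add S T _ _ hS hT =>
    obtain ⟨q, hq⟩ := hS p
    obtain ⟨r, hr⟩ := hT p
    exact ⟨q + r, by rw [map_add, hq, hr, add_mul]⟩
  | mul S T _ _ hS hT =>
    obtain ⟨q, hq⟩ := hT p
    obtain ⟨r, hr⟩ := hS q
    exact ⟨r, by rw [hr, hq, mul_assoc]⟩

/-- Normal ordering as a linear isomorphism from symbols to differential operators. -/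
def fullSymbolEquiv (n : ℕ) : Pol n ≃ₗ[ℂ] DiffOp n :=
  LinearEquiv.ofBijective
    ((fullSymbolMap n).codRestrict (DiffOp n).toSubmodule fullSymbolMap_mem_diffOp)
    ⟨fun _ _ h => fullSymbolMap_injective (congrArg Subtype.val h), fun T => by
      obtain ⟨q, hq⟩ := exists_fullSymbolMap_eq_mul T.2 1
      exact ⟨q, Subtype.ext (by rw [LinearMap.codRestrict_apply, hq, fullSymbolMap_one, mul_one])⟩⟩

theorem coe_fullSymbolEquiv (p : Pol n) :
    (fullSymbolEquiv n p : Module.End ℂ (Smooth n)) = fullSymbolMap n p := rfl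

theorem C_smul (c : ℂ) (f : Smooth n) : (C (c • f) : Pol n) = c • C f :=
  (MvPolynomial.smul_monomial c).symm

/-- The fibrewise linear symbol `Σ vᵢ ξᵢ` of the vector field `Σ vᵢ ∂/∂uᵢ`. -/
def fieldSymbol (v : Fin n → Smooth n) : Pol n := ∑ i, C (v i) * X i

/-- The Lie derivative `Σ vᵢ ∂ᵢ + λ div v` of `λ`-densities along the vector field `v`. -/
def lieDerivative (lam : ℂ) (v : Fin n → Smooth n) : Module.End ℂ (Smooth n) :=
  ∑ i, mulOp (v i) * pd i + lam • mulOp (∑ i, pd i (v i))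

theorem momentum_eq_fieldSymbol (x : Matrix (Fin (n + 1)) (Fin (n + 1)) ℝ) :
    momentum x = fieldSymbol (vf x) := rfl

theorem lieDensity_eq_lieDerivative (lam : ℂ) (x : Matrix (Fin (n + 1)) (Fin (n + 1)) ℝ) :
    lieDensity lam x = lieDerivative lam (vf x) := rfl

theorem euler_fieldSymbol (v : Fin n → Smooth n) : euler n (fieldSymbol v) = fieldSymbol v := by
  simp only [fieldSymbol, map_sum, euler_mul, euler_C, euler_X, zero_mul, zero_add]

theorem dXi_fieldSymbol (i : Fin n) (v : Fin n → Smooth n) : dXi i (fieldSymbol v) = C (v i) := by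
  simp only [fieldSymbol, map_sum, dXi_mul, dXi_C, dXi_X, zero_mul, zero_add, mul_ite, mul_one,
    mul_zero, Finset.sum_ite_eq, Finset.mem_univ, if_true]

theorem opD_fieldSymbol (v : Fin n → Smooth n) :
    opD n (fieldSymbol v) = C (∑ i, pd i (v i)) := by
  simp only [opD_apply, dXi_fieldSymbol, dU_C, map_sum]

theorem hessPairing_fieldSymbol_right (p : Pol n) (v : Fin n → Smooth n) :
    hessPairing n p (fieldSymbol v) = 0 := by
  simp only [hessPairing_apply, dXi_fieldSymbol, dXi_C, mul_zero, Finset.sum_const_zero]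

theorem hessPairing_mul_X_left (p q : Pol n) (k : Fin n) :
    hessPairing n (p * X k) q = X k * hessPairing n p q := by
  simp only [hessPairing_apply, dU_mul, dU_X, mul_zero, add_zero, Finset.mul_sum]
  exact Finset.sum_congr rfl fun i _ => Finset.sum_congr rfl fun j _ => by ring

theorem mulOp_commutator {f : Smooth n} (hf : ∀ i j, pd i (pd j f) = 0) (p : Pol n) :
    mulOp f * fullSymbolMap n p - fullSymbolMap n p * mulOp f =
      fullSymbolMap n (poissonₗ n (C f) p) := by
  rw [fullSymbolMap_mul_mulOp fun i j k => by rw [hf, map_zero], hessPairing_C_eq_zero hf,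
    ← fullSymbolMap_C_mul, ← map_sub, smul_zero, add_zero, sub_sub_cancel]

theorem mulOp_mul_pd_commutator {f : Smooth n} (hf : ∀ i j k, pd i (pd j (pd k f)) = 0)
    (l : Fin n) (p : Pol n) :
    mulOp f * pd l * fullSymbolMap n p - fullSymbolMap n p * (mulOp f * pd l) =
      fullSymbolMap n
        (poissonₗ n (C f * X l) p - (1 / 2 : ℂ) • hessPairing n (C f * X l) p) := by
  rw [mul_assoc, pd_mul_fullSymbolMap, ← fullSymbolMap_C_mul, ← mul_assoc,
    fullSymbolMap_mul_mulOp hf, ← fullSymbolMap_X_mul, ← map_sub, poisson_mul_left,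
    poisson_X_left, hessPairing_mul_X_left, mul_add, mul_add, mul_sub, mul_smul_comm,
    mul_left_comm (X l), mul_comm (poissonₗ n (C f) p)]
  refine congrArg _ ?_
  abel

theorem lieDerivative_commutator (lam : ℂ) {v : Fin n → Smooth n}
    (hv : ∀ i j k l, pd i (pd j (pd k (v l))) = 0) (p : Pol n) :
    lieDerivative lam v * fullSymbolMap n p - fullSymbolMap n p * lieDerivative lam v =
      fullSymbolMap n (poissonₗ n (fieldSymbol v) p + lam • poissonₗ n (opD n (fieldSymbol v)) p -
        (1 / 2 : ℂ) • hessPairing n (fieldSymbol v) p) := by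
  have hfield : (∑ i, mulOp (v i) * pd i) * fullSymbolMap n p -
      fullSymbolMap n p * ∑ i, mulOp (v i) * pd i = fullSymbolMap n
        (poissonₗ n (fieldSymbol v) p - (1 / 2 : ℂ) • hessPairing n (fieldSymbol v) p) := by
    simp only [fieldSymbol, Finset.sum_mul, Finset.mul_sum, ← Finset.sum_sub_distrib, map_sum,
      LinearMap.sum_apply, Finset.smul_sum, mulOp_mul_pd_commutator fun i j k => hv i j k _]
  have hdiv : lam • mulOp (∑ i, pd i (v i)) * fullSymbolMap n p -
      fullSymbolMap n p * lam • mulOp (∑ i, pd i (v i)) =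
        fullSymbolMap n (lam • poissonₗ n (opD n (fieldSymbol v)) p) := by
    have hpd (i j : Fin n) : pd i (pd j (∑ k, pd k (v k))) = 0 := by
      simp only [map_sum, hv, Finset.sum_const_zero]
    rw [map_smul, opD_fieldSymbol, ← mulOp_commutator hpd, smul_sub, smul_mul_assoc, mul_smul_comm]
  rw [lieDerivative, add_mul, mul_add, add_sub_add_comm, hfield, hdiv, ← map_add]
  refine congrArg _ ?_
  abel

/-- The constant-coefficient vector field `Σ wⱼ ∂/∂ξⱼ` along the fibres. -/
def verticalField (w : Fin n → ℂ) : Module.End ℂ (Pol n) := ∑ j, w j • dXi j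

theorem verticalField_apply (w : Fin n → ℂ) (p : Pol n) :
    verticalField w p = ∑ j, w j • dXi j p := by
  simp [verticalField]

theorem opD_verticalField (w : Fin n → ℂ) (p : Pol n) :
    opD n (verticalField w p) = verticalField w (opD n p) := by
  simp only [verticalField_apply, map_sum, map_smul, opD_dXi]

section Momentum

/-- The coefficients of the quadratic part of the vector field induced by `x`, which is
`-(Σ wⱼ uⱼ) Σ uᵢ ∂/∂uᵢ`. -/
def quadCoeff (x : Matrix (Fin (n + 1)) (Fin (n + 1)) ℝ) (j : Fin n) : ℂ := x 0 j.succ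

variable (x : Matrix (Fin (n + 1)) (Fin (n + 1)) ℝ)

theorem commute_poisson_momentum_euler : Commute (poissonₗ n (momentum x)) (euler n) :=
  LinearMap.ext fun p => by
    rw [Module.End.mul_apply, Module.End.mul_apply, euler_poisson, momentum_eq_fieldSymbol,
      euler_fieldSymbol, add_sub_cancel_left]

theorem pd_linComp (k : Fin (n + 1)) (j : Fin n) : pd j (linComp x k) = (x k j.succ : ℂ) • 1 := by
  simp only [linComp, homCoord, Fin.sum_univ_succ, Fin.cons_zero, Fin.cons_succ, map_add, map_sum,
    map_smul, pd_one, pd_coord, smul_zero, smul_ite, zero_add, Finset.sum_ite_eq, Finset.mem_univ,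
    if_true]

theorem pd_pd_vf (i j k : Fin n) : pd i (pd j (vf x k)) =
    (-((if i = k then quadCoeff x j else 0) + if j = k then quadCoeff x i else 0) : ℂ) • 1 := by
  simp only [vf, map_sub, pd_mul, map_add, pd_linComp, pd_coord, map_smul, pd_one, quadCoeff]
  split_ifs <;> simp [pd_one, add_smul, add_comm]

theorem pd_pd_pd_vf (i j k l : Fin n) : pd i (pd j (pd k (vf x l))) = 0 := by
  rw [pd_pd_vf, map_smul, pd_one, smul_zero]

theorem pd_div_vf (i : Fin n) :
    pd i (∑ j, pd j (vf x j)) = -(((n : ℂ) + 1) * quadCoeff x i) • 1 := by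
  rw [map_sum]
  simp only [pd_pd_vf, ← Finset.sum_smul, Finset.sum_neg_distrib, Finset.sum_add_distrib, if_true,
    Finset.sum_ite_eq, Finset.mem_univ, Finset.sum_const, Finset.card_univ, Fintype.card_fin,
    nsmul_eq_mul]
  congr 1
  ring

theorem poisson_opD_momentum (p : Pol n) : poissonₗ n (opD n (momentum x)) p =
    ((n : ℂ) + 1) • verticalField (quadCoeff x) p := by
  rw [momentum_eq_fieldSymbol, opD_fieldSymbol, poisson_C_left, verticalField_apply,
    Finset.smul_sum, ← Finset.sum_neg_distrib]
  refine Finset.sum_congr rfl fun i _ => ?_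
  rw [pd_div_vf, neg_smul, map_neg, neg_mul, neg_neg, C_smul, map_one,
    smul_mul_assoc, one_mul, mul_smul]

theorem hessPairing_momentum (p : Pol n) : hessPairing n (momentum x) p =
    -(2 : ℂ) • euler n (verticalField (quadCoeff x) p) := by
  have hdU (i j : Fin n) : dU i (dU j (momentum x)) =
      -(quadCoeff x j • X i + quadCoeff x i • X j : Pol n) := by
    simp only [momentum, map_sum, dU_mul, dU_X, dU_C, mul_zero, add_zero, pd_pd_vf, C_smul, map_one,
      smul_one_mul]
    simp only [neg_smul, add_smul, ite_smul, zero_smul, Finset.sum_neg_distrib,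
      Finset.sum_add_distrib, Finset.sum_ite_eq, Finset.mem_univ, if_true]
  have heuler : euler n (verticalField (quadCoeff x) p) =
      ∑ i, ∑ j, quadCoeff x j • (X i * dXi i (dXi j p)) := by
    simp only [euler_apply, verticalField_apply, map_sum, map_smul, Finset.smul_sum]
    exact Finset.sum_comm
  have heuler' : euler n (verticalField (quadCoeff x) p) =
      ∑ i, ∑ j, quadCoeff x i • (X j * dXi i (dXi j p)) := by
    rw [heuler, Finset.sum_comm]
    simp only [dXi_dXi_comm]
  rw [neg_smul, two_smul]
  nth_rewrite 1 [heuler]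
  rw [heuler', hessPairing_apply]
  simp only [hdU, neg_mul, add_mul, smul_mul_assoc, Finset.sum_neg_distrib, Finset.sum_add_distrib]

theorem opD_poisson_momentum (p : Pol n) : opD n (poissonₗ n (momentum x) p) =
    poissonₗ n (momentum x) (opD n p) + den n 0 (verticalField (quadCoeff x) p) := by
  rw [opD_poisson, poisson_opD_momentum, hessPairing_momentum, momentum_eq_fieldSymbol,
    hessPairing_fieldSymbol_right]
  simp only [den, LinearMap.add_apply, LinearMap.smul_apply, Module.End.one_apply, Nat.cast_zero,
    zero_add]
  module

theorem lieDensity_commutator (lam : ℂ) (p : Pol n) :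
    lieDensity lam x * fullSymbolMap n p - fullSymbolMap n p * lieDensity lam x =
      fullSymbolMap n (poissonₗ n (momentum x) p + euler n (verticalField (quadCoeff x) p) +
        (lam * (n + 1)) • verticalField (quadCoeff x) p) := by
  rw [lieDensity_eq_lieDerivative, lieDerivative_commutator lam (pd_pd_pd_vf x),
    ← momentum_eq_fieldSymbol, poisson_opD_momentum, hessPairing_momentum]
  congr 1
  module

end Momentum

theorem isHomogeneous_iff_euler_eq {d : ℕ} {p : Pol n} :
    p.IsHomogeneous d ↔ euler n p = (d : ℂ) • p := by
  refine ⟨fun hp => MvPolynomial.ext _ _ fun a => ?_, fun hp a ha => ?_⟩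
  · rw [coeff_euler, MvPolynomial.coeff_smul]
    rcases eq_or_ne a.degree d with had | had
    · rw [had]
    · rw [hp.coeff_eq_zero had, smul_zero, smul_zero]
  · have hcoeff := congrArg (coeff a) hp
    rw [coeff_euler, MvPolynomial.coeff_smul] at hcoeff
    have had : a.degree = d := Nat.cast_injective (smul_left_injective ℂ ha hcoeff)
    rw [← had, Finsupp.degree_eq_weight_one]
    rfl

theorem mem_degreeLT_iff_homogeneousComponent {d : ℕ} {p : Pol n} :
    p ∈ degreeLT n d ↔ ∀ k, d ≤ k → homogeneousComponent k p = 0 := by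
  rw [mem_degreeLT_iff_coeff]
  refine ⟨fun hp k hk => MvPolynomial.ext _ _ fun a => ?_, fun hp a ha => ?_⟩
  · rw [MvPolynomial.coeff_homogeneousComponent, MvPolynomial.coeff_zero]
    exact ite_eq_right_iff.2 fun hak => hp a (hk.trans_eq hak.symm)
  · simpa [MvPolynomial.coeff_homogeneousComponent] using congrArg (coeff a) (hp a.degree ha)

theorem homogeneousComponent_map {T : Module.End ℂ (Pol n)}
    (hT : ∀ (d : ℕ) (p : Pol n), p.IsHomogeneous d → (T p).IsHomogeneous d) (k : ℕ) (p : Pol n) :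
    homogeneousComponent k (T p) = T (homogeneousComponent k p) := by
  conv_lhs => rw [← MvPolynomial.sum_homogeneousComponent p, map_sum, map_sum]
  simp only [MvPolynomial.homogeneousComponent_of_mem
    (hT _ _ (MvPolynomial.homogeneousComponent_isHomogeneous _ p)), Finset.sum_ite_eq,
    Finset.mem_range]
  refine ite_eq_left_iff.2 fun hk => ?_
  rw [MvPolynomial.homogeneousComponent_eq_zero _ _ (by omega), map_zero]

theorem isHomogeneous_map_of_commute_euler {T : Module.End ℂ (Pol n)} (hT : Commute T (euler n))
    {d : ℕ} {p : Pol n} (hp : p.IsHomogeneous d) : (T p).IsHomogeneous d := by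
  rw [isHomogeneous_iff_euler_eq] at hp ⊢
  rw [← map_smul, ← hp]
  exact (LinearMap.congr_fun hT.eq p).symm

theorem map_mem_degreeLT_of_commute_euler {T : Module.End ℂ (Pol n)} (hT : Commute T (euler n))
    {d : ℕ} {p : Pol n} (hp : p ∈ degreeLT n d) : T p ∈ degreeLT n d :=
  mem_degreeLT_iff_homogeneousComponent.2 fun k hk => by
    rw [homogeneousComponent_map fun _ _ => isHomogeneous_map_of_commute_euler hT,
      mem_degreeLT_iff_homogeneousComponent.1 hp k hk, map_zero]

theorem opD_pow_mem_degreeLT (k : ℕ) {d : ℕ} {p : Pol n} (hp : p ∈ degreeLT n (d + k)) :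
    (opD n ^ k) p ∈ degreeLT n d := by
  induction k generalizing d with
  | zero => exact hp
  | succ k ih =>
    rw [pow_succ', Module.End.mul_apply]
    exact opD_mem_degreeLT (ih (by rwa [add_right_comm, add_assoc]))

theorem opD_pow_eq_zero {d : ℕ} {p : Pol n} (hp : p ∈ degreeLT n d) : (opD n ^ d) p = 0 := by
  simpa only [degreeLT_zero, Submodule.mem_bot] using
    opD_pow_mem_degreeLT d (d := 0) (by rwa [zero_add])

theorem verticalField_mem_degreeLT {d : ℕ} {p : Pol n} (hp : p ∈ degreeLT n (d + 1))
    (w : Fin n → ℂ) : verticalField w p ∈ degreeLT n d := by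
  rw [verticalField_apply]
  exact sum_mem fun i _ => Submodule.smul_mem _ _ (dXi_mem_degreeLT hp i)

theorem opD_pow_euler (d : ℕ) (p : Pol n) :
    (opD n ^ d) (euler n p) = euler n ((opD n ^ d) p) + (d : ℂ) • (opD n ^ d) p := by
  induction d with
  | zero => simp
  | succ d ih =>
    rw [pow_succ', Module.End.mul_apply, ih, map_add, opD_euler, map_smul, Module.End.mul_apply,
      Nat.cast_succ]
    module

theorem opD_pow_verticalField (d : ℕ) (w : Fin n → ℂ) (p : Pol n) :
    (opD n ^ d) (verticalField w p) = verticalField w ((opD n ^ d) p) := by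
  have hcomm : Commute (opD n) (verticalField w) := LinearMap.ext (opD_verticalField w)
  exact LinearMap.congr_fun (hcomm.pow_left d).eq p

theorem opD_pow_succ_poisson_momentum (x : Matrix (Fin (n + 1)) (Fin (n + 1)) ℝ) (d : ℕ)
    (p : Pol n) : (opD n ^ (d + 1)) (poissonₗ n (momentum x) p) =
      poissonₗ n (momentum x) ((opD n ^ (d + 1)) p) +
        ((d : ℂ) + 1) • den n d ((opD n ^ d) (verticalField (quadCoeff x) p)) := by
  induction d with
  | zero => simpa using opD_poisson_momentum x p
  | succ d ih =>
    have hden (j : ℕ) (q : Pol n) : opD n (den n j q) = den n (j + 2) (opD n q) := by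
      simp only [den, LinearMap.add_apply, LinearMap.smul_apply, Module.End.one_apply, map_add,
        map_smul, opD_euler, Nat.cast_add]
      module
    have hpow (k : ℕ) (q : Pol n) : opD n ((opD n ^ k) q) = (opD n ^ (k + 1)) q := by
      rw [pow_succ', Module.End.mul_apply]
    rw [← hpow, ih, map_add, opD_poisson_momentum, map_smul, hden, ← opD_pow_verticalField, hpow,
      hpow, add_assoc]
    congr 1
    simp only [den, LinearMap.add_apply, LinearMap.smul_apply, Module.End.one_apply, Nat.cast_add]
    module

theorem gCoeff_zero (lam : ℂ) : gCoeff n lam 0 = 1 := by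
  simp [gCoeff]

theorem gCoeff_succ_mul_den (lam : ℂ) (d : ℕ) :
    ((d : ℂ) + 1) • (gCoeff n lam (d + 1) * den n d) =
      gCoeff n lam d * (-euler n - ((d : ℂ) + lam * (n + 1)) • 1) := by
  have hcast : (d : ℂ) + 1 ≠ 0 := Nat.cast_add_one_ne_zero d
  have hden : (↑(isUnit_den n d).unit⁻¹ : Module.End ℂ (Pol n)) * den n d = 1 :=
    (isUnit_den n d).val_inv_mul
  rw [gCoeff, gCoeff, List.range_succ, List.map_append, List.prod_append, List.map_singleton,
    List.prod_singleton, smul_mul_assoc, mul_assoc, mul_assoc, hden, mul_one, smul_smul,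
    smul_mul_assoc, Nat.factorial_succ, Nat.cast_mul, Nat.cast_succ, mul_inv,
    mul_inv_cancel_left₀ hcast]

theorem commute_gCoeff {T : Module.End ℂ (Pol n)} (hT : Commute T (euler n)) (lam : ℂ) (d : ℕ) :
    Commute T (gCoeff n lam d) := by
  refine Commute.smul_right (Commute.list_prod_right _ _ fun y hy => ?_) _
  obtain ⟨j, -, rfl⟩ := List.mem_map.1 hy
  have hden : Commute T (den n j) :=
    (hT.smul_right _).add_right ((Commute.one_right T).smul_right _)
  exact (hT.neg_right.sub_right ((Commute.one_right T).smul_right _)).mul_right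
    (Commute.units_inv_right hden)

theorem coeff_gOp (lam : ℂ) (p : Pol n) (k : ℕ) :
    (gOp lam p).coeff k = gCoeff n lam k ((opD n ^ k) p) := by
  simp only [gOp, Polynomial.coeff_add, Polynomial.coeff_C, Polynomial.finsetSum_coeff,
    Polynomial.coeff_monomial, Finset.sum_ite_eq', Finset.mem_Icc]
  rcases Nat.eq_zero_or_pos k with rfl | hk
  · simp [gCoeff_zero]
  · rw [if_neg hk.ne', zero_add]
    refine ite_eq_left_iff.2 fun hkp => ?_
    rw [opD_pow_eq_zero (degreeLT_mono (by omega) (mem_degreeLT_totalDegree p)), map_zero]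

/-- The operator `g_λ` at `t = 1`. -/
def gAtOne (n : ℕ) (lam : ℂ) : Module.End ℂ (Pol n) where
  toFun p := (gOp lam p).eval 1
  map_add' p q := by
    rw [← Polynomial.eval_add]
    congr 1
    ext1 k
    simp only [coeff_gOp, Polynomial.coeff_add, map_add]
  map_smul' c p := by
    rw [RingHom.id_apply, ← Polynomial.eval_smul]
    congr 1
    ext1 k
    simp only [coeff_gOp, Polynomial.coeff_smul, map_smul]

theorem gAtOne_eq_sum (lam : ℂ) {d : ℕ} {p : Pol n} (hp : p ∈ degreeLT n (d + 1)) :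
    gAtOne n lam p = ∑ k ∈ Finset.range (d + 1), gCoeff n lam k ((opD n ^ k) p) := by
  have hdeg : (gOp lam p).natDegree < d + 1 :=
    Nat.lt_succ_of_le <| Polynomial.natDegree_le_iff_coeff_eq_zero.2 fun k hk => by
      rw [coeff_gOp, opD_pow_eq_zero (degreeLT_mono hk hp), map_zero]
  refine (Polynomial.eval_eq_sum_range' hdeg 1).trans ?_
  simp only [one_pow, mul_one, coeff_gOp]

theorem gAtOne_sub_self_mem_degreeLT (lam : ℂ) {d : ℕ} {p : Pol n} (hp : p ∈ degreeLT n (d + 1)) :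
    gAtOne n lam p - p ∈ degreeLT n d := by
  rw [gAtOne_eq_sum lam hp, Finset.sum_range_succ', pow_zero, gCoeff_zero, Module.End.one_apply,
    Module.End.one_apply, add_sub_cancel_right]
  exact sum_mem fun k _ =>
    map_mem_degreeLT_of_commute_euler (commute_gCoeff (Commute.refl _) lam _).symm
      (opD_pow_mem_degreeLT _ (degreeLT_mono (by omega) hp))

/-- The operator `g_λ` at `t = 1` as an isomorphism; it is unipotent for the degree filtration. -/
def gEquiv (n : ℕ) (lam : ℂ) : Pol n ≃ₗ[ℂ] Pol n :=
  LinearEquiv.ofBijective (gAtOne n lam) <|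
    bijective_of_sub_mem degreeLT_zero degreeLT_mono (fun p => ⟨_, mem_degreeLT_totalDegree p⟩)
      fun _ _ => gAtOne_sub_self_mem_degreeLT lam

/- By the recursion for `g_{λ,k}`, the defect of invariance of `Dᵏ⁺¹` cancels, order by order, the
defect of equivariance of normal ordering. -/
theorem gCoeff_opD_pow_poisson_momentum (lam : ℂ) (x : Matrix (Fin (n + 1)) (Fin (n + 1)) ℝ) (k : ℕ)
    (p : Pol n) : gCoeff n lam (k + 1) ((opD n ^ (k + 1)) (poissonₗ n (momentum x) p)) =
      poissonₗ n (momentum x) (gCoeff n lam (k + 1) ((opD n ^ (k + 1)) p)) -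
        gCoeff n lam k ((opD n ^ k) (euler n (verticalField (quadCoeff x) p) +
          (lam * (n + 1)) • verticalField (quadCoeff x) p)) := by
  set A := verticalField (quadCoeff x)
  have hrec : gCoeff n lam (k + 1) (((k : ℂ) + 1) • den n k ((opD n ^ k) (A p))) =
      -gCoeff n lam k ((opD n ^ k) (euler n (A p) + (lam * (n + 1)) • A p)) := by
    rw [map_smul, map_add, opD_pow_euler, map_smul]
    refine (LinearMap.congr_fun (gCoeff_succ_mul_den lam k) _).trans ?_
    rw [Module.End.mul_apply, ← map_neg]
    congr 1
    simp only [LinearMap.sub_apply, LinearMap.neg_apply, LinearMap.smul_apply, Module.End.one_apply]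
    module
  rw [opD_pow_succ_poisson_momentum, map_add, hrec, ← sub_eq_add_neg]
  congr 1
  exact (LinearMap.congr_fun (commute_gCoeff (commute_poisson_momentum_euler x) lam _).eq _).symm

theorem gAtOne_poisson_momentum (lam : ℂ) (x : Matrix (Fin (n + 1)) (Fin (n + 1)) ℝ) (p : Pol n) :
    gAtOne n lam (poissonₗ n (momentum x) p + euler n (verticalField (quadCoeff x) p) +
      (lam * (n + 1)) • verticalField (quadCoeff x) p) =
      poissonₗ n (momentum x) (gAtOne n lam p) := by
  obtain ⟨d, hp⟩ : ∃ d, p ∈ degreeLT n (d + 1) := ⟨_, mem_degreeLT_totalDegree p⟩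
  have hA : verticalField (quadCoeff x) p ∈ degreeLT n (d + 1) :=
    degreeLT_mono d.le_succ (verticalField_mem_degreeLT hp _)
  have hV : poissonₗ n (momentum x) p ∈ degreeLT n (d + 1) :=
    map_mem_degreeLT_of_commute_euler (commute_poisson_momentum_euler x) hp
  rw [add_assoc, map_add, gAtOne_eq_sum lam (degreeLT_mono (Nat.le_succ _) hV),
    gAtOne_eq_sum lam (degreeLT_mono (Nat.le_succ _) hp), gAtOne_eq_sum lam (add_mem
      (map_mem_degreeLT_of_commute_euler (Commute.refl _) hA) (Submodule.smul_mem _ _ hA)),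
    Finset.sum_range_succ', Finset.sum_range_succ' _ (d + 1)]
  simp only [gCoeff_opD_pow_poisson_momentum, Finset.sum_sub_distrib, map_add, map_sum, pow_zero,
    gCoeff_zero, Module.End.one_apply]
  abel

/-- The equivariant quantization, which is normal ordering after the inverse of `g_λ` at `t = 1`. -/
def projQuant (n : ℕ) (lam : ℂ) : Pol n ≃ₗ[ℂ] DiffOp n :=
  (gEquiv n lam).symm.trans (fullSymbolEquiv n)

theorem projQuant_gAtOne (lam : ℂ) (p : Pol n) :
    projQuant n lam (gAtOne n lam p) = fullSymbolEquiv n p :=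
  congrArg (fullSymbolEquiv n) ((gEquiv n lam).symm_apply_apply p)

theorem isEquivariantQuantization_projQuant (n : ℕ) (lam : ℂ) :
    IsEquivariantQuantization lam (projQuant n lam) where
  symbol d φ hφ := by
    obtain ⟨q, hq, rfl⟩ := exists_mem_eq_of_sub_mem degreeLT_zero degreeLT_mono
      (fun _ _ => gAtOne_sub_self_mem_degreeLT lam) _ φ (mem_degreeLT_of_isHomogeneous hφ)
    refine ⟨hφ, q - gAtOne n lam q, mem_degreeLT.1 ?_, ?_⟩
    · rw [← neg_sub]
      exact neg_mem (gAtOne_sub_self_mem_degreeLT lam hq)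
    · rw [projQuant_gAtOne, add_sub_cancel]
      rfl
  equivariant x φ := by
    obtain ⟨q, rfl⟩ := (gEquiv n lam).surjective φ
    change (projQuant n lam (poissonₗ n (momentum x.1) (gAtOne n lam q))).1 =
      lieDensity lam x.1 * (projQuant n lam (gAtOne n lam q)).1 -
        (projQuant n lam (gAtOne n lam q)).1 * lieDensity lam x.1
    rw [← gAtOne_poisson_momentum, projQuant_gAtOne, projQuant_gAtOne, coe_fullSymbolEquiv,
      coe_fullSymbolEquiv, lieDensity_commutator]

/-- The momenta conjugate to the homogeneous coordinates, restricted to the big cell; `ξ₀` is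
determined by `Σ uₐ ξₐ = 0`. -/
def homMomentum (n : ℕ) : Fin (n + 1) → Pol n := Fin.cons (-∑ i, C (coord i) * X i) X

theorem poisson_antisymm (p q : Pol n) : poissonₗ n q p = -poissonₗ n p q := by
  simp only [poissonₗ_apply, ← Finset.sum_neg_distrib, neg_sub, mul_comm]

theorem poisson_mul_eq_add (p p' q : Pol n) :
    poissonₗ n (p * p') q = poissonₗ n p (p' * q) + poissonₗ n p' (p * q) := by
  rw [poisson_mul_left, poisson_mul_right, poisson_mul_right, poisson_antisymm p p']
  ring

theorem sum_homCoord_mul_homMomentum : ∑ a, C (homCoord n a) * homMomentum n a = 0 := by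
  simp [Fin.sum_univ_succ, homCoord, homMomentum]

theorem sum_homMomentum_mul_poisson_homCoord (p : Pol n) :
    ∑ a, homMomentum n a * poissonₗ n (C (homCoord n a)) p = -euler n p := by
  simp only [Fin.sum_univ_succ, homMomentum, homCoord, Fin.cons_zero, Fin.cons_succ,
    poisson_C_left, pd_one, pd_coord, euler_apply, map_zero, zero_mul, Finset.sum_const_zero,
    mul_zero, zero_add, apply_ite (C : Smooth n →+* Pol n), map_one, ite_mul, one_mul,
    Finset.sum_ite_eq', Finset.mem_univ, if_true, mul_neg, Finset.sum_neg_distrib]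

theorem sum_homCoord_mul_poisson_homMomentum (p : Pol n) :
    ∑ a, C (homCoord n a) * poissonₗ n (homMomentum n a) p = euler n p := by
  have hzero : ∑ a, poissonₗ n (C (homCoord n a) * homMomentum n a) p = 0 := by
    rw [← LinearMap.sum_apply, ← map_sum, sum_homCoord_mul_homMomentum, map_zero,
      LinearMap.zero_apply]
  have hmul (a : Fin (n + 1)) : poissonₗ n (C (homCoord n a) * homMomentum n a) p =
      C (homCoord n a) * poissonₗ n (homMomentum n a) p +
        homMomentum n a * poissonₗ n (C (homCoord n a)) p := by
    rw [poisson_mul_left, mul_comm (poissonₗ n _ p)]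
  rw [Finset.sum_congr rfl fun a _ => hmul a, Finset.sum_add_distrib,
    sum_homMomentum_mul_poisson_homCoord] at hzero
  exact add_neg_eq_zero.1 hzero

theorem sum_poisson_homMomentum_homCoord :
    ∑ a, poissonₗ n (homMomentum n a) (C (homCoord n a)) = n := by
  simp [Fin.sum_univ_succ, homCoord, homMomentum, poisson_X_left, dU_C, pd_coord, poisson_one_right]

theorem momentum_eq_sum (x : Matrix (Fin (n + 1)) (Fin (n + 1)) ℝ) :
    momentum x = ∑ a, ∑ b, (x a b : ℂ) • (C (homCoord n b) * homMomentum n a) := by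
  have hlin (a : Fin (n + 1)) : ∑ b, (x a b : ℂ) • (C (homCoord n b) * homMomentum n a) =
      C (linComp x a) * homMomentum n a := by
    simp only [linComp, map_sum, C_smul, Finset.sum_mul, smul_mul_assoc]
  rw [Finset.sum_congr rfl fun a _ => hlin a, Fin.sum_univ_succ, homMomentum, Fin.cons_zero,
    mul_neg, neg_add_eq_sub, Finset.mul_sum, momentum, ← Finset.sum_sub_distrib]
  refine Finset.sum_congr rfl fun i _ => ?_
  rw [vf, map_sub, map_mul, Fin.cons_succ]
  ring

theorem momentum_single (a b : Fin (n + 1)) :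
    momentum (Matrix.single a b (1 : ℝ)) = C (homCoord n b) * homMomentum n a := by
  simp [momentum_eq_sum, Matrix.single_apply, ite_and]

theorem momentum_sub_smul_one (x : Matrix (Fin (n + 1)) (Fin (n + 1)) ℝ) (c : ℝ) :
    momentum (x - c • (1 : Matrix (Fin (n + 1)) (Fin (n + 1)) ℝ)) = momentum x := by
  simp only [momentum_eq_sum, Matrix.sub_apply, Matrix.smul_apply, Matrix.one_apply,
    Complex.ofReal_sub, sub_smul, Finset.sum_sub_distrib, smul_eq_mul, mul_ite, mul_one, mul_zero,
    apply_ite Complex.ofReal, Complex.ofReal_zero, ite_smul, zero_smul, Finset.sum_ite_eq,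
    Finset.mem_univ, if_true, ← Finset.smul_sum, sum_homCoord_mul_homMomentum, smul_zero, sub_zero]

theorem sum_homCoord_mul_poisson (f p : Pol n) :
    ∑ a, C (homCoord n a) * poissonₗ n (f * homMomentum n a) p = f * euler n p := by
  have hmul (a : Fin (n + 1)) : C (homCoord n a) * poissonₗ n (f * homMomentum n a) p =
      f * (C (homCoord n a) * poissonₗ n (homMomentum n a) p) +
        poissonₗ n f p * (C (homCoord n a) * homMomentum n a) := by
    rw [poisson_mul_left]
    ring
  rw [Finset.sum_congr rfl fun a _ => hmul a, Finset.sum_add_distrib, ← Finset.mul_sum,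
    ← Finset.mul_sum, sum_homCoord_mul_homMomentum, sum_homCoord_mul_poisson_homMomentum, mul_zero,
    add_zero]

theorem sum_homMomentum_mul_poisson (f p : Pol n) :
    ∑ a, homMomentum n a * poissonₗ n (C (homCoord n a) * f) p = -(f * euler n p) := by
  have hmul (a : Fin (n + 1)) : homMomentum n a * poissonₗ n (C (homCoord n a) * f) p =
      poissonₗ n f p * (C (homCoord n a) * homMomentum n a) +
        f * (homMomentum n a * poissonₗ n (C (homCoord n a)) p) := by
    rw [poisson_mul_left]
    ring
  rw [Finset.sum_congr rfl fun a _ => hmul a, Finset.sum_add_distrib, ← Finset.mul_sum,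
    ← Finset.mul_sum, sum_homCoord_mul_homMomentum, sum_homMomentum_mul_poisson_homCoord, mul_zero,
    zero_add, mul_neg]

theorem sum_poisson_homMomentum (p : Pol n) :
    ∑ a, poissonₗ n (homMomentum n a) (C (homCoord n a) * p) = euler n p + (n : ℂ) • p := by
  simp only [poisson_mul_right, Finset.sum_add_distrib, ← Finset.sum_mul]
  rw [sum_poisson_homMomentum_homCoord, sum_homCoord_mul_poisson_homMomentum, add_comm,
    Nat.cast_smul_eq_nsmul, nsmul_eq_mul]

theorem sum_poisson_homCoord (p : Pol n) :
    ∑ a, poissonₗ n (C (homCoord n a)) (homMomentum n a * p) = -(euler n p + (n : ℂ) • p) := by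
  rw [eq_neg_iff_add_eq_zero, ← sum_poisson_homMomentum, ← Finset.sum_add_distrib]
  simp only [← poisson_mul_eq_add]
  rw [← LinearMap.sum_apply, ← map_sum, sum_homCoord_mul_homMomentum, map_zero,
    LinearMap.zero_apply]

/- The left-hand side is the action of the Casimir element of `gl(n+1)`. -/
theorem sum_poisson_momentum_single_mul :
    ∑ a, ∑ b, poissonₗ n (momentum (Matrix.single a b 1)) *
        poissonₗ n (momentum (Matrix.single b a 1)) =
      (2 : ℂ) • (euler n * euler n + (n : ℂ) • euler n) := by
  refine LinearMap.ext fun p => ?_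
  set h := fun a => (C (homCoord n a) : Pol n)
  set ξ := homMomentum n
  calc (∑ a, ∑ b, poissonₗ n (momentum (Matrix.single a b 1)) *
        poissonₗ n (momentum (Matrix.single b a 1))) p
      = ∑ a, ∑ b, poissonₗ n (h b * ξ a) (poissonₗ n (h a * ξ b) p) := by
        simp only [LinearMap.sum_apply, Module.End.mul_apply, momentum_single, h, ξ]
    _ = ∑ b, poissonₗ n (h b) (∑ a, ξ a * poissonₗ n (h a * ξ b) p) +
          ∑ a, poissonₗ n (ξ a) (∑ b, h b * poissonₗ n (h a * ξ b) p) := by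
        simp only [map_sum, poisson_mul_eq_add (h _) (ξ _) (poissonₗ n _ p), Finset.sum_add_distrib]
        exact congrArg₂ _ Finset.sum_comm rfl
    _ = -∑ b, poissonₗ n (h b) (ξ b * euler n p) + ∑ a, poissonₗ n (ξ a) (h a * euler n p) := by
        simp only [h, ξ, sum_homCoord_mul_poisson, sum_homMomentum_mul_poisson, map_neg,
          Finset.sum_neg_distrib]
    _ = (2 : ℂ) • (euler n (euler n p) + (n : ℂ) • euler n p) := by
        rw [sum_poisson_homCoord, sum_poisson_homMomentum, neg_neg, two_smul]

theorem commute_poisson_momentum_of_sl {T : Module.End ℂ (Pol n)}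
    (hT : ∀ x : LieAlgebra.SpecialLinear.sl (Fin (n + 1)) ℝ, Commute T (poissonₗ n (momentum x.1)))
    (y : Matrix (Fin (n + 1)) (Fin (n + 1)) ℝ) : Commute T (poissonₗ n (momentum y)) := by
  set c : ℝ := y.trace / (n + 1)
  have hn : (n : ℝ) + 1 ≠ 0 := Nat.cast_add_one_ne_zero n
  have htrace : Matrix.trace (y - c • (1 : Matrix (Fin (n + 1)) (Fin (n + 1)) ℝ)) = 0 := by
    simp [Matrix.trace_sub, Matrix.trace_smul, c, div_mul_cancel₀ _ hn]
  rw [← momentum_sub_smul_one y c]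
  exact hT ⟨y - c • 1, htrace⟩

theorem isHomogeneous_map_of_commute_momentum {T : Module.End ℂ (Pol n)}
    (hT : ∀ y : Matrix (Fin (n + 1)) (Fin (n + 1)) ℝ, Commute T (poissonₗ n (momentum y)))
    {d : ℕ} {p : Pol n} (hp : p.IsHomogeneous d) : (T p).IsHomogeneous d := by
  have hcasimir : Commute T ((2 : ℂ) • (euler n * euler n + (n : ℂ) • euler n)) := by
    rw [← sum_poisson_momentum_single_mul]
    exact Commute.sum_right _ _ _ fun a _ => Commute.sum_right _ _ _ fun b _ =>
      (hT _).mul_right (hT _)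
  have heigen : (2 : ℂ) • (euler n (euler n (T p)) + (n : ℂ) • euler n (T p)) =
      (2 * (d * (d + n)) : ℂ) • T p := by
    refine (LinearMap.congr_fun hcasimir.eq p).symm.trans ?_
    change T ((2 : ℂ) • (euler n (euler n p) + (n : ℂ) • euler n p)) = _
    rw [← map_smul T (2 * (d * (d + n)) : ℂ) p]
    refine congrArg T ?_
    rw [isHomogeneous_iff_euler_eq.1 hp, map_smul, isHomogeneous_iff_euler_eq.1 hp]
    module
  intro a ha
  have hcoeff := congrArg (coeff a) heigen
  simp only [MvPolynomial.coeff_smul, MvPolynomial.coeff_add, coeff_euler, smul_smul,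
    ← add_smul] at hcoeff
  have heq : a.degree * (a.degree + n) = d * (d + n) := by
    have := smul_left_injective ℂ ha hcoeff
    have hc : (a.degree * (a.degree + n) : ℂ) = d * (d + n) := by linear_combination this / 2
    exact_mod_cast hc
  have had : a.degree = d := by
    rcases lt_trichotomy a.degree d with h | h | h
    · nlinarith
    · exact h
    · nlinarith
  rw [← had, Finsupp.degree_eq_weight_one]
  rfl

theorem eq_one_of_commute_momentum {T : Module.End ℂ (Pol n)}
    (hcomm : ∀ y : Matrix (Fin (n + 1)) (Fin (n + 1)) ℝ, Commute T (poissonₗ n (momentum y)))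
    (hsymbol : ∀ {d : ℕ} {p : Pol n}, p.IsHomogeneous d → T p - p ∈ degreeLT n d) : T = 1 := by
  have hfix {d : ℕ} {p : Pol n} (hp : p.IsHomogeneous d) : T p = p := by
    have hhom : (T p - p).IsHomogeneous d :=
      (isHomogeneous_map_of_commute_momentum hcomm hp).sub hp
    have hzero := mem_degreeLT_iff_homogeneousComponent.1 (hsymbol hp) d le_rfl
    rwa [MvPolynomial.homogeneousComponent_of_mem hhom, if_pos rfl, sub_eq_zero] at hzero
  refine LinearMap.ext fun p => ?_
  rw [← MvPolynomial.sum_homogeneousComponent p, map_sum, map_sum]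
  exact Finset.sum_congr rfl fun i _ =>
    hfix (MvPolynomial.homogeneousComponent_isHomogeneous i p)

theorem eq_projQuant_of_isEquivariantQuantization {lam : ℂ} {Q : Pol n ≃ₗ[ℂ] DiffOp n}
    (hQ : IsEquivariantQuantization lam Q) : Q = projQuant n lam := by
  set P := projQuant n lam
  have hP : IsEquivariantQuantization lam P := isEquivariantQuantization_projQuant n lam
  set T : Module.End ℂ (Pol n) := (Q.trans P.symm).toLinearMap
  have hPT (p : Pol n) : P (T p) = Q p := P.apply_symm_apply (Q p)
  have hcomm := commute_poisson_momentum_of_sl (T := T) fun x => LinearMap.ext fun p =>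
    P.injective <| Subtype.ext <| by
      rw [Module.End.mul_apply, Module.End.mul_apply, hPT]
      refine (hQ.equivariant x p).trans ?_
      rw [← hPT]
      exact (hP.equivariant x (T p)).symm
  have hsymbol {d : ℕ} {p : Pol n} (hp : p.IsHomogeneous d) : T p - p ∈ degreeLT n d := by
    obtain ⟨-, r, hr, hQr⟩ := hQ.symbol d p hp
    have hr : r ∈ degreeLT n d := mem_degreeLT.2 hr
    have hTp : T p = gAtOne n lam (p + r) := P.injective <| Subtype.ext <| by
      rw [hPT, hQr, projQuant_gAtOne]
      rfl
    have h := add_mem (gAtOne_sub_self_mem_degreeLT lam (add_mem (mem_degreeLT_of_isHomogeneous hp)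
      (degreeLT_mono d.le_succ hr))) hr
    rwa [← hTp, sub_add_eq_sub_sub, sub_add_cancel] at h
  refine LinearEquiv.ext fun p => ?_
  rw [← hPT p, eq_one_of_commute_momentum hcomm hsymbol, Module.End.one_apply]

theorem coeff_quantT (Q : Pol n ≃ₗ[ℂ] DiffOp n) (P : (Pol n)[X]) (k : ℕ) :
    (quantT Q P).coeff k =
      Q (∑ m ∈ Finset.range (k + 1), homogeneousComponent (k - m) (P.coeff m)) := by
  have hsummand (m : ℕ) (φ : Pol n) : (∑ d ∈ Finset.range (φ.totalDegree + 1),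
      Polynomial.monomial (d + m) (Q (homogeneousComponent d φ))).coeff k =
        if m ≤ k then Q (homogeneousComponent (k - m) φ) else 0 := by
    simp only [Polynomial.finsetSum_coeff, Polynomial.coeff_monomial]
    split_ifs with h
    · rw [Finset.sum_eq_single (k - m) (fun d _ hd => if_neg (by omega)) fun hd => ?_,
        if_pos (Nat.sub_add_cancel h)]
      rw [MvPolynomial.homogeneousComponent_eq_zero _ _ (by rw [Finset.mem_range] at hd; omega),
        map_zero, ite_self]
    · exact Finset.sum_eq_zero fun d _ => if_neg (by omega)
  rw [quantT, Polynomial.sum, Polynomial.finsetSum_coeff, map_sum]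
  simp only [hsummand]
  rw [← Finset.sum_filter]
  refine Finset.sum_subset (fun m hm => ?_) fun m hm hm' => ?_
  · exact Finset.mem_range_succ_iff.2 (Finset.mem_filter.1 hm).2
  · have hcoeff : P.coeff m = 0 := by
      simpa [Finset.mem_range_succ_iff.1 hm] using hm'
    rw [hcoeff, map_zero, map_zero]

theorem quantT_injective (Q : Pol n ≃ₗ[ℂ] DiffOp n) : Function.Injective (quantT Q) := by
  intro P P' h
  refine Polynomial.ext fun m => MvPolynomial.ext _ _ fun b => ?_
  have hcoeff (R : (Pol n)[X]) : coeff b (∑ l ∈ Finset.range (b.degree + m + 1),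
      homogeneousComponent (b.degree + m - l) (R.coeff l)) = coeff b (R.coeff m) := by
    simp only [MvPolynomial.coeff_sum, MvPolynomial.coeff_homogeneousComponent]
    rw [Finset.sum_eq_single_of_mem m (Finset.mem_range.2 (by omega)) fun l hl hlm => if_neg ?_,
      if_pos (Nat.add_sub_cancel _ _).symm]
    have := Finset.mem_range.1 hl
    omega
  have hQ := congrArg (Polynomial.coeff · (b.degree + m)) h
  simp only [coeff_quantT] at hQ
  rw [← hcoeff P, ← hcoeff P', Q.injective hQ]

theorem quantT_C_C (Q : Pol n ≃ₗ[ℂ] DiffOp n) (f : Smooth n) :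
    quantT Q (Polynomial.C (C f)) = Polynomial.C (Q (C f)) := by
  refine Polynomial.ext fun k => ?_
  rw [coeff_quantT, Finset.sum_eq_single_of_mem 0 (Finset.mem_range.2 k.succ_pos) fun m _ hm => by
      rw [Polynomial.coeff_C_of_ne_zero hm, map_zero], Polynomial.coeff_C_zero, Nat.sub_zero,
    MvPolynomial.homogeneousComponent_of_mem (MvPolynomial.isHomogeneous_C _ f),
    Polynomial.coeff_C, apply_ite Q, map_zero]

theorem homogeneousComponent_opD (d : ℕ) (p : Pol n) :
    homogeneousComponent d (opD n p) = opD n (homogeneousComponent (d + 1) p) := by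
  have hcoeff (q : Pol n) (b : Fin n →₀ ℕ) :
      coeff b (opD n q) =
        ∑ i, pd i (((b i + 1 : ℕ) : ℂ) • coeff (b + Finsupp.single i 1) q) := by
    simp only [opD_apply, MvPolynomial.coeff_sum, coeff_dU, coeff_dXi]
  refine MvPolynomial.ext _ _ fun b => ?_
  simp only [hcoeff, MvPolynomial.coeff_homogeneousComponent, map_add, Finsupp.degree_single,
    add_left_inj]
  split_ifs <;> simp

theorem homogeneousComponent_opD_pow (m d : ℕ) (p : Pol n) :
    homogeneousComponent d ((opD n ^ m) p) = (opD n ^ m) (homogeneousComponent (d + m) p) := by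
  induction m generalizing d with
  | zero => rfl
  | succ m ih =>
    rw [pow_succ', Module.End.mul_apply, homogeneousComponent_opD, ih, Module.End.mul_apply,
      add_right_comm, add_assoc]

theorem homogeneousComponent_gCoeff (lam : ℂ) (m d : ℕ) (p : Pol n) :
    homogeneousComponent d (gCoeff n lam m p) = gCoeff n lam m (homogeneousComponent d p) :=
  homogeneousComponent_map (fun _ _ hq =>
    isHomogeneous_map_of_commute_euler (commute_gCoeff (Commute.refl _) lam m).symm hq) d p

theorem coeff_quantT_gOp (lam : ℂ) (p : Pol n) (k : ℕ) :
    (quantT (projQuant n lam) (gOp lam p)).coeff k =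
      fullSymbolEquiv n (homogeneousComponent k p) := by
  rw [coeff_quantT, ← projQuant_gAtOne, gAtOne_eq_sum lam
    (mem_degreeLT_of_isHomogeneous (MvPolynomial.homogeneousComponent_isHomogeneous k p))]
  refine congrArg _ (Finset.sum_congr rfl fun m hm => ?_)
  rw [coeff_gOp, homogeneousComponent_gCoeff, homogeneousComponent_opD_pow,
    Nat.sub_add_cancel (Finset.mem_range_succ_iff.1 hm)]

theorem gOp_of_opD_eq_zero (lam : ℂ) {p : Pol n} (hp : opD n p = 0) :
    gOp lam p = Polynomial.C p := by
  rw [gOp, add_eq_left]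
  refine Finset.sum_eq_zero fun d hd => ?_
  obtain ⟨k, rfl⟩ := Nat.exists_eq_add_of_le' (Finset.mem_Icc.1 hd).1
  rw [pow_succ, Module.End.mul_apply, hp, map_zero, map_zero, map_zero]

theorem quantT_gOp_C_mul (lam : ℂ) (φ : Smooth n) (ψ : Pol n) :
    quantT (projQuant n lam) (gOp lam (C φ * ψ)) =
      quantT (projQuant n lam) (Polynomial.C (C φ)) * quantT (projQuant n lam) (gOp lam ψ) := by
  have hφ : projQuant n lam (C φ) = fullSymbolEquiv n (C φ) := by
    have h := coeff_quantT_gOp lam (C φ) 0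
    rwa [gOp_of_opD_eq_zero lam (opD_C φ), quantT_C_C, Polynomial.coeff_C_zero,
      MvPolynomial.homogeneousComponent_of_mem (MvPolynomial.isHomogeneous_C _ φ),
      if_pos rfl] at h
  refine Polynomial.ext fun k => ?_
  rw [quantT_C_C, Polynomial.coeff_C_mul, coeff_quantT_gOp, coeff_quantT_gOp,
    MvPolynomial.homogeneousComponent_C_mul, hφ]
  refine Subtype.ext ?_
  rw [coe_fullSymbolEquiv, fullSymbolMap_C_mul, ← fullSymbolMap_C]
  rfl

theorem opD_fibrePoly (ψ : MvPolynomial (Fin n) ℂ) : opD n (fibrePoly ψ) = 0 := by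
  have hdU (i : Fin n) : dU i (fibrePoly ψ) = 0 := by
    refine MvPolynomial.ext _ _ fun b => ?_
    rw [coeff_dU, fibrePoly, MvPolynomial.coeff_map, Algebra.algebraMap_eq_smul_one, map_smul,
      pd_one, smul_zero, MvPolynomial.coeff_zero]
  simp only [opD_apply, ← dXi_dU_comm, hdU, map_zero, Finset.sum_const_zero]

end ProjStar

end

theorem proposition4_general (n : ℕ) (lam : ℂ) :
    (∃! Q : ProjStar.Pol n ≃ₗ[ℂ] ProjStar.DiffOp n, ProjStar.IsEquivariantQuantization lam Q) ∧
    ∀ Q : ProjStar.Pol n ≃ₗ[ℂ] ProjStar.DiffOp n, ProjStar.IsEquivariantQuantization lam Q →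
      Function.Injective (ProjStar.quantT Q) ∧
      ∀ (φ : ProjStar.Smooth n) (ψ : ProjStar.Pol n),
        ProjStar.quantT Q (ProjStar.star Q (Polynomial.C (MvPolynomial.C φ))
            (ProjStar.gOp lam ψ)) =
          ProjStar.quantT Q (Polynomial.C (MvPolynomial.C φ)) *
            ProjStar.quantT Q (ProjStar.gOp lam ψ) ∧
        ProjStar.star Q (Polynomial.C (MvPolynomial.C φ)) (ProjStar.gOp lam ψ) =
          ProjStar.gOp lam (MvPolynomial.C φ * ψ) := by
  refine ⟨⟨ProjStar.projQuant n lam, ProjStar.isEquivariantQuantization_projQuant n lam,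
    fun Q hQ => ProjStar.eq_projQuant_of_isEquivariantQuantization hQ⟩, fun Q hQ => ?_⟩
  obtain rfl := ProjStar.eq_projQuant_of_isEquivariantQuantization hQ
  refine ⟨ProjStar.quantT_injective _, fun φ ψ => ?_⟩
  have hstar : ProjStar.star (ProjStar.projQuant n lam) (Polynomial.C (MvPolynomial.C φ))
      (ProjStar.gOp lam ψ) = ProjStar.gOp lam (MvPolynomial.C φ * ψ) := by
    rw [ProjStar.star, ← ProjStar.quantT_gOp_C_mul]
    exact Function.leftInverse_invFun (ProjStar.quantT_injective _) _
  exact ⟨by rw [hstar, ProjStar.quantT_gOp_C_mul], hstar⟩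

theorem proposition4 (n : ℕ) (lam : ℂ) :
    (∃! Q : ProjStar.Pol n ≃ₗ[ℂ] ProjStar.DiffOp n, ProjStar.IsEquivariantQuantization lam Q) ∧
    ∀ Q : ProjStar.Pol n ≃ₗ[ℂ] ProjStar.DiffOp n, ProjStar.IsEquivariantQuantization lam Q →
      Function.Injective (ProjStar.quantT Q) ∧
      ∀ (φ : ProjStar.Smooth n) (ψ : MvPolynomial (Fin n) ℂ),
        ProjStar.quantT Q (ProjStar.star Q (Polynomial.C (MvPolynomial.C φ))
            (Polynomial.C (ProjStar.fibrePoly ψ))) =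
          ProjStar.quantT Q (Polynomial.C (MvPolynomial.C φ)) *
            ProjStar.quantT Q (Polynomial.C (ProjStar.fibrePoly ψ)) ∧
        ProjStar.star Q (Polynomial.C (MvPolynomial.C φ)) (Polynomial.C (ProjStar.fibrePoly ψ)) =
          ProjStar.gOp lam (MvPolynomial.C φ * ProjStar.fibrePoly ψ) := by
  obtain ⟨hunique, hstar⟩ := proposition4_general n lam
  exact ⟨hunique, fun Q hQ => ⟨(hstar Q hQ).1, fun φ ψ =>
    ProjStar.gOp_of_opD_eq_zero lam (ProjStar.opD_fibrePoly ψ) ▸ (hstar Q hQ).2 φ _⟩⟩
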